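/- **Setting.** Let $\mathcal A$ be a finite set of $n_a$ units. For $a,r\in\mathcal A$ let $E_{ar}:\{0,1\}^{\mathcal A}\to\{0,1\}$ be edge potential outcomes (whether the directed edge $(a,r)$ exists, as a function of the treatment assignment), let $w_{ar},u_{ar}\in\mathbb R$ be weights with $w_{aa}=u_{aa}=0$, and let $\alpha_a,\beta_a,\gamma_a\in\mathbb R$. For $t\in\{0,1\}^{\mathcal A}$ put $$x_a(t)=\sum_r t_rE_{ar}(t)w_{ar},\qquad Y_a(t)=\alpha_a+\beta_ax_a(t)+\gamma_at_a,\qquad z_a(t)=\sum_r t_ru_{ar}.$$ The total treatment effect is $\mu=\frac1{n_a}\sum_a[Y_a(\mathbf 1)-Y_a(\mathbf 0)]$. Let $\mathbf T=(T_r)_{r\in\mathcal A}$ be the random treatment assignment, write $e_{ar},x_a,y_a,z_a$ for $E_{ar}(\mathbf T),x_a(\mathbf T),Y_a(\mathbf T),z_a(\mathbf T)$, and, for $c_{ar}\in\mathbb R$, define $$\hat\beta_a=\frac{y_a(z_a-\mathbb E z_a)}{\mathrm{Cov}(x_a,z_a)},\quad \hat W_a=\sum_r\Big[\frac{T_rw_{ar}(e_{ar}-c_{ar})}{p}+w_{ar}c_{ar}\Big],\quad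 \hat\gamma_a=\frac{T_ay_a}{p}-\frac{(1-T_a)y_a}{1-p},$$ $$\hat\mu_{uni}=\frac1{n_a}\sum_a\big[\hat\beta_a\hat W_a+\hat\gamma_a\big].$$ Let $R_a=\{r:E_{ar}(\mathbf 1)=1\}$, $A_r=\{a:E_{ar}(\mathbf 1)=1\}$, $V_a=\{r:u_{ar}\neq0\}$, $d_{\mathcal A}=\max_a|R_a|$, $d_{\mathcal R}=\max_r|A_r|$. **Assumptions.** Let $p_0>0$, $W_l>0$, $W_h$, $M$ be constants. The $T_r$ are independent Bernoulli($p$) with $p_0\le p\le1-p_0$, and there is a set $G\subset\mathcal A\times\mathcal A$ such that: 1. $E_{ar}(t)$ depends only on $t_r$; 2. $E_{ar}(t)=1$ for all $t$ and all $(a,r)\in G$; 3. $u_{ar}\ne0$ implies $(a,r)\in G$; 4. $c_{ar}=1$ if $(a,r)\in G$ and $c_{ar}=0$ otherwise; 5. $w_{ar}\neq0$ for all $(a,r)\in G$ with $r\ne a$; 6. $V_a\neq\emptyset$ for all $a$, and $u_{ar}\ge0$ for all $a,r$; 7. $W_l/|R_a|\le|w_{ar}|\le W_h/|R_a|$ for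 all $a$ and all $r\in R_a$, $r\neq a$; 8. for each $a$, the weights $w_{ar}$, $r\in V_a$, all have the same sign; 9. $|Y_a(t)|\le M$ for all $a,t$. **Corollary 2.** (i) There is a constant $C$ depending only on $p_0,W_l,W_h,M$ such that $\mathrm{Var}(\hat\mu_{uni})\le C\,d_{\mathcal A}^3d_{\mathcal R}/n_a$ under these assumptions. Consequently, along any sequence of such experiments (with the same constants $p_0,W_l,W_h,M$) with $d_{\mathcal A}^3d_{\mathcal R}/n_a\to0$, the estimator is consistent: $\hat\mu_{uni}-\mu\to0$ in probability. (ii) Along any sequence of such experiments (with the same constants) for which $n_a\mathrm{Var}(\hat\mu_{uni})$ is bounded away from zero and $d_{\mathcal A}^{10}d_{\mathcal R}^4/n_a\to0$, the standardized estimator $(\hat\mu_{uni}-\mu)/\sqrt{\mathrm{Var}(\hat\mu_{uni})}$ converges in distribution to $\mathcal N(0,1)$. -/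

import Mathlib

open MeasureTheory ProbabilityTheory Filter Topology

noncomputable section

/-- The numerical value in `{0, 1}` of a treatment indicator or an edge indicator. -/
def bit (b : Bool) : ℝ := if b then 1 else 0

/-- The data of an experiment on an endogenous unipartite (directed) interference graph with set of
units `ι` (these are both the analysis units and the randomization units), together with the
choices of the researcher. A treatment assignment is a vector `t : ι → Bool`. -/
structure UnipartiteExperiment (ι : Type*) where
  /-- edge potential outcomes: `E a r t` says whether the edge `(a, r)` exists under `t` -/
  E : ι → ι → (ι → Bool) → Bool
  /-- intercepts -/
  α : ι → ℝ
  /-- indirect effects per unit of exposure -/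
  β : ι → ℝ
  /-- direct effects -/
  γ : ι → ℝ
  /-- exposure weights -/
  w : ι → ι → ℝ
  /-- instrument weights -/
  u : ι → ι → ℝ
  /-- augmentation coefficients -/
  c : ι → ι → ℝ
  /-- the (candidate) anchor subgraph -/
  G : Set (ι × ι)

namespace UnipartiteExperiment

variable {ι : Type*} [Fintype ι] {Ω : Type*} [MeasurableSpace Ω]

/-- The exposure `x_a(t) = ∑_r t_r E_{ar}(t) w_{ar}`. -/
def exposure (X : UnipartiteExperiment ι) (a : ι) (t : ι → Bool) : ℝ :=
  ∑ r, bit (t r) * bit (X.E a r t) * X.w a r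

/-- The potential outcome `Y_a(t) = α_a + β_a x_a(t) + γ_a t_a`. -/
def outcome (X : UnipartiteExperiment ι) (a : ι) (t : ι → Bool) : ℝ :=
  X.α a + X.β a * X.exposure a t + X.γ a * bit (t a)

/-- The total treatment effect `μ = (1/n_a) ∑_a [Y_a(1) - Y_a(0)]`. -/
def totalEffect (X : UnipartiteExperiment ι) : ℝ :=
  (1 / (Fintype.card ι : ℝ)) *
    ∑ a, (X.outcome a (fun _ => true) - X.outcome a (fun _ => false))

/-- The instrument `z_a(t) = ∑_r t_r u_{ar}`. -/
def instrument (X : UnipartiteExperiment ι) (a : ι) (t : ι → Bool) : ℝ :=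
  ∑ r, bit (t r) * X.u a r

/-- `R_a`, the units `r` to which `a` is connected under full treatment. -/
def outNbrs (X : UnipartiteExperiment ι) (a : ι) : Finset ι :=
  Finset.univ.filter fun r => X.E a r (fun _ => true) = true

/-- `A_r`, the units `a` that are connected to `r` under full treatment. -/
def inNbrs (X : UnipartiteExperiment ι) (r : ι) : Finset ι :=
  Finset.univ.filter fun a => X.E a r (fun _ => true) = true

/-- `d_A = max_a |R_a|`. -/
def dA (X : UnipartiteExperiment ι) : ℕ := Finset.univ.sup fun a => (X.outNbrs a).card

/-- `d_R = max_r |A_r|`. -/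
def dR (X : UnipartiteExperiment ι) : ℕ := Finset.univ.sup fun r => (X.inNbrs r).card

/-- The estimator `β̂_a = y_a (z_a - 𝔼 z_a) / Cov(x_a, z_a)`, where the treatment assignment is the
random vector `T` on the probability space `(Ω, P)`. -/
def betaHat (X : UnipartiteExperiment ι) (P : Measure Ω) (T : Ω → ι → Bool) (a : ι) (ω : Ω) : ℝ :=
  X.outcome a (T ω) * (X.instrument a (T ω) - ∫ ω', X.instrument a (T ω') ∂P) /
    cov[fun ω' => X.exposure a (T ω'), fun ω' => X.instrument a (T ω'); P]

/-- The estimator `∑_r (T_r w_{ar} (e_{ar} - c_{ar}) / p + w_{ar} c_{ar})` of the total weight of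
the edges that `a` has under full treatment. -/
def weightHat (X : UnipartiteExperiment ι) (p : ℝ) (T : Ω → ι → Bool) (a : ι) (ω : Ω) : ℝ :=
  ∑ r, (bit (T ω r) * X.w a r * (bit (X.E a r (T ω)) - X.c a r) / p + X.w a r * X.c a r)

/-- The estimator `γ̂_a = T_a y_a / p - (1 - T_a) y_a / (1 - p)` of the direct effect. -/
def gammaHat (X : UnipartiteExperiment ι) (p : ℝ) (T : Ω → ι → Bool) (a : ι) (ω : Ω) : ℝ :=
  bit (T ω a) * X.outcome a (T ω) / p - (1 - bit (T ω a)) * X.outcome a (T ω) / (1 - p)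

/-- The estimator `μ̂_uni` of the total treatment effect. -/
def muHat (X : UnipartiteExperiment ι) (P : Measure Ω) (p : ℝ) (T : Ω → ι → Bool) (ω : Ω) : ℝ :=
  (1 / (Fintype.card ι : ℝ)) *
    ∑ a, (X.betaHat P T a ω * X.weightHat p T a ω + X.gammaHat p T a ω)

/-- The treatment assignments are independent Bernoulli random variables with probability `p`. -/
structure IsBernoulliDesign (P : Measure Ω) (p : ℝ) (T : Ω → ι → Bool) : Prop where
  measurable : ∀ r, Measurable fun ω => T ω r
  indep : iIndepFun (fun r ω => T ω r) P
  prob : ∀ r, P.real {ω | T ω r = true} = p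

/-- The assumptions on the experiment other than the assignment mechanism, with the constants
`Wl`, `Wh`, `M`. The conditions on the size of `w a r` are for `r ≠ a`, since `w a a = 0`; a unit
may or may not be connected to itself. -/
structure Assumptions (X : UnipartiteExperiment ι) (Wl Wh M : ℝ) : Prop where
  /-- edges are `r`-driven -/
  r_driven : ∀ a r t t', t r = t' r → X.E a r t = X.E a r t'
  /-- `G` is an anchor subgraph -/
  anchor : ∀ a r, (a, r) ∈ X.G → ∀ t, X.E a r t = true
  u_support : ∀ a r, X.u a r ≠ 0 → (a, r) ∈ X.G
  c_eq : ∀ a r, X.c a r = X.G.indicator 1 (a, r)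
  w_ne_zero : ∀ a r, (a, r) ∈ X.G → r ≠ a → X.w a r ≠ 0
  exists_u_ne_zero : ∀ a, ∃ r, X.u a r ≠ 0
  u_nonneg : ∀ a r, 0 ≤ X.u a r
  w_lower : ∀ a, ∀ r ∈ X.outNbrs a, r ≠ a → Wl / (X.outNbrs a).card ≤ |X.w a r|
  w_upper : ∀ a, ∀ r ∈ X.outNbrs a, r ≠ a → |X.w a r| ≤ Wh / (X.outNbrs a).card
  /-- the weights of the edges used by the instrument of `a` have the same sign -/
  w_same_sign : ∀ a r s, X.u a r ≠ 0 → X.u a s ≠ 0 → 0 < X.w a r * X.w a s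
  outcome_bound : ∀ a t, |X.outcome a t| ≤ M
  w_self : ∀ a, X.w a a = 0
  u_self : ∀ a, X.u a a = 0

end UnipartiteExperiment

end

/-!
*Normal approximation.* Let `W = ∑ ξ_k` be centred with variance `1`, and let `S_k` be the sum of
`ξ` over the dependency neighbourhood of `k`. Since `ξ_k` is independent of `W - S_k`, the terms
`𝔼[ξ_k exp(is(W - S_k))]` vanish; subtracting them from `𝔼[W exp(isW)]` and expanding to first
order in `S_k` shows that the characteristic function `φ` of `W` almost solves the equation
`φ' = -sφ` of the Gaussian one. The error consists of third moments and of the deviation of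
`∑ ξ_k S_k` from its mean `1`, which its variance controls. The integrating factor `exp(s²/2)`
turns the differential inequality into a bound on `φ(t) - exp(-t²/2)`.

*The estimator.* The unit `a` contributes a function of the treatments of `R_a ∪ {a}`, so at most
`(d_A + 1)(d_R + 1)` contributions overlap with a given one, and each of them is `O(d_A / n_a)`
because `Cov(x_a, z_a) = p(1 - p) ∑ w_{ar} u_{ar}` is of order at least `∑ u_{ar} / d_A`.
The estimator is unbiased because the instrument depends only on treatments of anchor neighbours
`r ≠ a`, whereas `Ŵ_a`, and `y_a` without the effect of the anchor edges, depend only on the other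
treatments: the expectation of `β̂_a Ŵ_a` factorizes.
-/

section DependencyNeighbourhoods

variable {κ Ω E F : Type*} [MeasurableSpace Ω] [MeasurableSpace E] [MeasurableSpace F]
  {P : Measure Ω}

/-- `N` is a system of *dependency neighbourhoods* for the family `ξ`: a finite subfamily is
independent of every finite subfamily that avoids its neighbourhoods. This is the local dependence
condition of Stein's method; it is not required that `k ∈ N k`. -/
structure HasDependencyNbhds (ξ : κ → Ω → E) (N : κ → Finset κ) (P : Measure Ω) : Prop where
  symm : ∀ {k l : κ}, l ∈ N k → k ∈ N l
  indepFun : ∀ S S' : Finset κ, (∀ k ∈ S, Disjoint (N k) S') →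
    IndepFun (fun ω (k : S) => ξ k ω) (fun ω (k : S') => ξ k ω) P

lemma indepFun_of_dependsOn [IsProbabilityMeasure P] {β : κ → Type*}
    [∀ k, MeasurableSpace (β k)] {X : ∀ k, Ω → β k} {S S' : Finset κ}
    (hX : IndepFun (fun ω (k : S) => X k ω) (fun ω (k : S') => X k ω) P)
    {f : (∀ k, β k) → E} {g : (∀ k, β k) → F} (hf : Measurable f) (hg : Measurable g)
    (hfS : DependsOn f (S : Set κ)) (hgS : DependsOn g (S' : Set κ)) :
    IndepFun (fun ω => f fun k => X k ω) (fun ω => g fun k => X k ω) P := by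
  classical
  obtain ⟨ω₀⟩ := P.nonempty_of_neZero
  have hext (U : Finset κ) (ω : Ω) : ∀ k ∈ (U : Set κ),
      Function.updateFinset (fun k => X k ω₀) U (fun k => X k ω) k = X k ω := fun k hk => by
    simp only [Function.updateFinset, Finset.mem_coe.1 hk, dite_true]
  have hf' := hf.comp (measurable_updateFinset (s := S) (x := fun k => X k ω₀))
  have hg' := hg.comp (measurable_updateFinset (s := S') (x := fun k => X k ω₀))
  exact (hX.comp hf' hg').congr (.of_forall fun ω => hfS (hext S ω))
    (.of_forall fun ω => hgS (hext S' ω))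

open Classical in
/-- The indices whose coordinate set meets that of `k`, where `S k` is the set of coordinates on
which the `k`-th member of a family of functions depends. -/
noncomputable def overlapNbhd {ι : Type*} [Fintype κ] (S : κ → Finset ι) (k : κ) : Finset κ :=
  Finset.univ.filter fun l => ¬ Disjoint (S k) (S l)

lemma mem_overlapNbhd {ι : Type*} [Fintype κ] {S : κ → Finset ι} {k l : κ} :
    l ∈ overlapNbhd S k ↔ ¬ Disjoint (S k) (S l) := by
  simp [overlapNbhd]

lemma hasDependencyNbhds_overlapNbhd [IsProbabilityMeasure P] {ι : Type*} [Fintype κ]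
    {β : ι → Type*} [∀ i, MeasurableSpace (β i)] {X : ∀ i, Ω → β i}
    (hX : ∀ i, Measurable (X i)) (hind : iIndepFun X P) {S : κ → Finset ι}
    {f : κ → (∀ i, β i) → E} (hf : ∀ k, Measurable (f k))
    (hfS : ∀ k, DependsOn (f k) (S k : Set ι)) :
    HasDependencyNbhds (fun k ω => f k fun i => X i ω) (overlapNbhd S) P where
  symm := by simp only [mem_overlapNbhd, disjoint_comm, imp_self, implies_true]
  indepFun U U' h := by
    classical
    have hdisj : Disjoint (U.biUnion S) (U'.biUnion S) := by
      simp only [Finset.disjoint_biUnion_left, Finset.disjoint_biUnion_right]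
      intro l hl k hk
      by_contra hkl
      exact Finset.disjoint_left.1 (h k hk) (mem_overlapNbhd.2 hkl) hl
    have hdep (V : Finset κ) :
        DependsOn (fun x (k : V) => f k x) (V.biUnion S : Finset ι) := fun x y hxy =>
      funext fun k => hfS k fun i hi => hxy i (Finset.mem_biUnion.2 ⟨k, k.2, hi⟩)
    have hmeas (V : Finset κ) : Measurable fun x (k : V) => f k x :=
      measurable_pi_lambda _ fun k => hf k
    exact indepFun_of_dependsOn (hind.indepFun_finset _ _ hdisj hX) (hmeas U) (hmeas U')
      (hdep U) (hdep U')

namespace HasDependencyNbhds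

variable {ξ : κ → Ω → E} {N : κ → Finset κ}

lemma comp (h : HasDependencyNbhds ξ N P) {φ : κ → E → F} (hφ : ∀ k, Measurable (φ k)) :
    HasDependencyNbhds (fun k ω => φ k (ξ k ω)) N P where
  symm := h.symm
  indepFun S S' hS :=
    have hmeas (V : Finset κ) : Measurable fun (x : V → E) (k : V) => φ k (x k) :=
      measurable_pi_lambda _ fun k => (hφ k).comp (measurable_pi_apply k)
    (h.indepFun S S' hS).comp (hmeas S) (hmeas S')

lemma indepFun_apply (h : HasDependencyNbhds ξ N P) {k l : κ} (hl : l ∉ N k) :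
    IndepFun (ξ k) (ξ l) P :=
  have heval (j : κ) :
      Measurable fun x : ({j} : Finset κ) → E => x ⟨j, Finset.mem_singleton_self j⟩ :=
    measurable_pi_apply _
  (h.indepFun {k} {l} (by simpa using hl)).comp (heval k) (heval l)

end HasDependencyNbhds

end DependencyNeighbourhoods

section VarianceOfSums

open Finset

variable {κ Ω : Type*} [MeasurableSpace Ω] {P : Measure Ω}

lemma covariance_le_of_variance_le [IsFiniteMeasure P] {X Y : Ω → ℝ} {V : ℝ} (hX : MemLp X 2 P)
    (hY : MemLp Y 2 P) (hXV : Var[X; P] ≤ V) (hYV : Var[Y; P] ≤ V) : cov[X, Y; P] ≤ V := by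
  linarith [variance_nonneg (X - Y) P, variance_sub hX hY]

lemma variance_sum_le_of_covariance_eq_zero [IsFiniteMeasure P] {s : Finset κ} {Y : κ → Ω → ℝ}
    {N : κ → Finset κ} {D : ℕ} {V : ℝ} (hY : ∀ k ∈ s, MemLp (Y k) 2 P)
    (hcov : ∀ k ∈ s, ∀ l ∈ s, l ∉ N k → cov[Y k, Y l; P] = 0)
    (hV : ∀ k ∈ s, Var[Y k; P] ≤ V) (hN : ∀ k ∈ s, #(N k) ≤ D) :
    Var[fun ω => ∑ k ∈ s, Y k ω; P] ≤ #s * D * V := by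
  classical
  rw [variance_fun_sum' hY]
  have hrow : ∀ k ∈ s, ∑ l ∈ s, cov[Y k, Y l; P] ≤ D * V := by
    intro k hk
    have hV0 : 0 ≤ V := (variance_nonneg _ _).trans (hV k hk)
    calc ∑ l ∈ s, cov[Y k, Y l; P]
        = ∑ l ∈ s with l ∈ N k, cov[Y k, Y l; P] :=
          (sum_filter_of_ne fun l hl hne => by_contra fun h => hne (hcov k hk l hl h)).symm
      _ ≤ ∑ l ∈ s with l ∈ N k, V := sum_le_sum fun l hl =>
          have hl := (mem_filter.1 hl).1
          covariance_le_of_variance_le (hY k hk) (hY l hl) (hV k hk) (hV l hl)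
      _ = #{l ∈ s | l ∈ N k} * V := by rw [sum_const, nsmul_eq_mul]
      _ ≤ D * V := by
          gcongr
          exact (card_le_card fun l hl => (mem_filter.1 hl).2).trans (hN k hk)
  calc ∑ k ∈ s, ∑ l ∈ s, cov[Y k, Y l; P] ≤ ∑ _k ∈ s, D * V := sum_le_sum hrow
    _ = #s * D * V := by rw [sum_const, nsmul_eq_mul, mul_assoc]

lemma variance_le_sq_of_abs_le [IsProbabilityMeasure P] {X : Ω → ℝ} {B : ℝ} (hX : AEMeasurable X P)
    (hB : ∀ᵐ ω ∂P, |X ω| ≤ B) : Var[X; P] ≤ B ^ 2 := by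
  have := variance_le_sq_of_bounded (hB.mono fun ω h => abs_le.1 h) hX
  ring_nf at this ⊢
  exact this

/-- The square of `∑ k, x k` with only the products of neighbours kept. -/
def localSq [Fintype κ] (N : κ → Finset κ) (x : κ → ℝ) : ℝ := ∑ k, x k * ∑ l ∈ N k, x l

lemma memLp_top_localSq [Fintype κ] {ξ : κ → Ω → ℝ} (hξ : ∀ k, MemLp (ξ k) ⊤ P)
    (N : κ → Finset κ) : MemLp (fun ω => localSq N fun k => ξ k ω) ⊤ P :=
  memLp_finsetSum _ fun k _ => (memLp_finsetSum (N k) fun l _ => hξ l).mul (hξ k)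

namespace HasDependencyNbhds

variable {ξ : κ → Ω → ℝ} {N : κ → Finset κ} {B : ℝ} {D : ℕ}

lemma variance_sum_le [IsProbabilityMeasure P] [Fintype κ] (h : HasDependencyNbhds ξ N P)
    (hξ : ∀ k, AEMeasurable (ξ k) P) (hB : ∀ k, ∀ᵐ ω ∂P, |ξ k ω| ≤ B) (hN : ∀ k, #(N k) ≤ D) :
    Var[fun ω => ∑ k, ξ k ω; P] ≤ Fintype.card κ * D * B ^ 2 := by
  have hL (k) : MemLp (ξ k) 2 P := .of_bound (hξ k).aestronglyMeasurable B (hB k)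
  exact variance_sum_le_of_covariance_eq_zero (s := univ) (fun k _ => hL k)
    (fun k _ l _ hl => (h.indepFun_apply hl).covariance_eq_zero (hL k) (hL l))
    (fun k _ => variance_le_sq_of_abs_le (hξ k) (hB k)) fun k _ => hN k

lemma indepFun_mul_mul [IsProbabilityMeasure P] [DecidableEq κ] (h : HasDependencyNbhds ξ N P)
    {k l k' l' : κ} (hd : Disjoint (N k ∪ N l) {k', l'}) :
    IndepFun (fun ω => ξ k ω * ξ l ω) (fun ω => ξ k' ω * ξ l' ω) P := by
  rw [disjoint_union_left] at hd
  refine indepFun_of_dependsOn (X := ξ) (f := fun x => x k * x l) (g := fun x => x k' * x l')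
    (h.indepFun {k, l} {k', l'} (by simpa using hd)) (by fun_prop) (by fun_prop) ?_ ?_ <;>
  · intro x y hxy
    simp only [hxy _ (mem_coe.2 (mem_insert_self _ _)),
      hxy _ (mem_coe.2 (mem_insert_of_mem (mem_singleton_self _)))]

lemma card_pairs_not_disjoint_le [Fintype κ] [DecidableEq κ] (h : HasDependencyNbhds ξ N P)
    (hN : ∀ k, #(N k) ≤ D) (k l : κ) :
    #{q ∈ univ.sigma N | ¬ Disjoint (N k ∪ N l) {q.1, q.2}} ≤ 4 * D ^ 2 := by
  set M := N k ∪ N l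
  have hMN : #(M.sigma N) ≤ 2 * D ^ 2 := calc
    #(M.sigma N) ≤ #M * D := by
      rw [card_sigma, ← smul_eq_mul]
      exact sum_le_card_nsmul _ _ _ fun k _ => hN k
    _ ≤ (D + D) * D := by gcongr; exact (card_union_le _ _).trans (add_le_add (hN k) (hN l))
    _ = 2 * D ^ 2 := by ring
  have hsub : {q ∈ univ.sigma N | ¬ Disjoint M {q.1, q.2}} ⊆
      M.sigma N ∪ (M.sigma N).image (fun q => (⟨q.2, q.1⟩ : Σ _ : κ, κ)) := by
    rintro ⟨k', l'⟩ hq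
    simp only [mem_filter, mem_sigma, mem_univ, true_and, disjoint_insert_right,
      disjoint_singleton_right, not_and_or, not_not] at hq
    obtain ⟨hl', hk' | hl'M⟩ := hq
    · exact mem_union_left _ (mem_sigma.2 ⟨hk', hl'⟩)
    · exact mem_union_right _ (mem_image.2 ⟨⟨l', k'⟩, mem_sigma.2 ⟨hl'M, h.symm hl'⟩, rfl⟩)
  have hswap : #((M.sigma N).image fun q => (⟨q.2, q.1⟩ : Σ _ : κ, κ)) ≤ #(M.sigma N) :=
    card_image_le
  exact (card_le_card hsub).trans ((card_union_le _ _).trans (by linarith))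

lemma variance_localSq_le [IsProbabilityMeasure P] [Fintype κ] (h : HasDependencyNbhds ξ N P)
    (hξ : ∀ k, AEMeasurable (ξ k) P) (hB : ∀ k, ∀ᵐ ω ∂P, |ξ k ω| ≤ B) (hN : ∀ k, #(N k) ≤ D) :
    Var[fun ω => localSq N fun k => ξ k ω; P] ≤ 4 * Fintype.card κ * D ^ 3 * B ^ 4 := by
  classical
  have hmeas (q : Σ _ : κ, κ) : AEMeasurable (fun ω => ξ q.1 ω * ξ q.2 ω) P :=
    (hξ q.1).mul (hξ q.2)
  have hbound (q : Σ _ : κ, κ) : ∀ᵐ ω ∂P, |ξ q.1 ω * ξ q.2 ω| ≤ B ^ 2 := by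
    filter_upwards [hB q.1, hB q.2] with ω h₁ h₂
    rw [abs_mul, sq]
    exact mul_le_mul h₁ h₂ (abs_nonneg _) ((abs_nonneg _).trans h₁)
  have hL (q : Σ _ : κ, κ) : MemLp (fun ω => ξ q.1 ω * ξ q.2 ω) 2 P :=
    .of_bound (hmeas q).aestronglyMeasurable (B ^ 2) (hbound q)
  have hcov : ∀ q ∈ univ.sigma N, ∀ q' ∈ univ.sigma N,
      q' ∉ {q' ∈ univ.sigma N | ¬ Disjoint (N q.1 ∪ N q.2) {q'.1, q'.2}} →
      cov[fun ω => ξ q.1 ω * ξ q.2 ω, fun ω => ξ q'.1 ω * ξ q'.2 ω; P] = 0 := by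
    intro q _ q' hq' hqq'
    rw [mem_filter, and_iff_right hq', not_not] at hqq'
    exact (h.indepFun_mul_mul hqq').covariance_eq_zero (hL q) (hL q')
  have hcard : (#(univ.sigma N) : ℝ) ≤ Fintype.card κ * D := by
    rw [card_sigma]
    exact_mod_cast sum_le_card_nsmul _ _ _ fun k _ => hN k
  calc Var[fun ω => localSq N fun k => ξ k ω; P]
      = Var[fun ω => ∑ q ∈ univ.sigma N, ξ q.1 ω * ξ q.2 ω; P] := by
        simp only [localSq, mul_sum, sum_sigma]
    _ ≤ #(univ.sigma N) * ((4 * D ^ 2 : ℕ) : ℝ) * (B ^ 2) ^ 2 :=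
        variance_sum_le_of_covariance_eq_zero (fun q _ => hL q) hcov
          (fun q _ => variance_le_sq_of_abs_le (hmeas q) (hbound q))
          fun q _ => h.card_pairs_not_disjoint_le hN q.1 q.2
    _ ≤ Fintype.card κ * D * ((4 * D ^ 2 : ℕ) : ℝ) * (B ^ 2) ^ 2 := by gcongr
    _ = 4 * Fintype.card κ * D ^ 3 * B ^ 4 := by push_cast; ring

lemma integral_localSq [Fintype κ] (h : HasDependencyNbhds ξ N P) (hL : ∀ k, MemLp (ξ k) 2 P)
    (h0 : ∀ k, P[ξ k] = 0) :
    ∫ ω, localSq N (fun k => ξ k ω) ∂P = ∫ ω, (∑ k, ξ k ω) ^ 2 ∂P := by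
  have h_int (k l) : Integrable (fun ω => ξ k ω * ξ l ω) P := (hL k).integrable_mul (hL l)
  have hzero {k l} (hl : l ∉ N k) : ∫ ω, ξ k ω * ξ l ω ∂P = 0 := by
    rw [(h.indepFun_apply hl).integral_fun_mul_eq_mul_integral (hL k).1 (hL l).1, h0, zero_mul]
  simp only [localSq, sq, sum_mul_sum]
  simp only [mul_sum]
  rw [integral_finsetSum _ fun k _ => integrable_finsetSum _ fun l _ => h_int k l,
    integral_finsetSum _ fun k _ => integrable_finsetSum _ fun l _ => h_int k l]
  refine sum_congr rfl fun k _ => ?_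
  rw [integral_finsetSum _ fun l _ => h_int k l, integral_finsetSum _ fun l _ => h_int k l]
  exact sum_subset (subset_univ _) fun l _ hl => hzero hl

end HasDependencyNbhds

end VarianceOfSums

lemma tendsto_measure_le_abs_sub_integral {κ : Type*} {l : Filter κ} {Ω : κ → Type*}
    [∀ n, MeasurableSpace (Ω n)] {P : ∀ n, Measure (Ω n)} [∀ n, IsProbabilityMeasure (P n)]
    {Z : ∀ n, Ω n → ℝ} (hZ : ∀ n, MemLp (Z n) 2 (P n))
    (hvar : Tendsto (fun n => Var[Z n; P n]) l (𝓝 0)) {ε : ℝ} (hε : 0 < ε) :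
    Tendsto (fun n => P n {ω | ε ≤ |Z n ω - ∫ ω', Z n ω' ∂P n|}) l (𝓝 0) := by
  have hlim := ENNReal.tendsto_ofReal (hvar.div_const (ε ^ 2))
  rw [zero_div, ENNReal.ofReal_zero] at hlim
  exact tendsto_of_tendsto_of_tendsto_of_le_of_le tendsto_const_nhds hlim (fun _ => zero_le)
    fun n => meas_ge_le_variance_div_sq (hZ n) hε

section SteinMethod

open Finset Complex

lemma norm_exp_mul_I_sub_one_sub_le (x : ℝ) : ‖exp (x * I) - 1 - x * I‖ ≤ 2 * x ^ 2 := by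
  have hx : ‖(x : ℂ) * I‖ = |x| := by simp
  rcases le_total |x| 1 with h | h
  · have := norm_exp_sub_one_sub_id_le (x := x * I) (by rwa [hx])
    rw [hx, sq_abs] at this
    nlinarith [sq_nonneg x]
  · have hexp : ‖exp (x * I) - 1‖ ≤ |x| := by
      simpa [mul_comm] using Real.norm_exp_I_mul_ofReal_sub_one_le (x := x)
    calc ‖exp (x * I) - 1 - x * I‖ ≤ ‖exp (x * I) - 1‖ + ‖(x : ℂ) * I‖ := norm_sub_le _ _
      _ ≤ |x| + |x| := add_le_add hexp hx.le
      _ ≤ 2 * x ^ 2 := by nlinarith [sq_abs x]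

lemma norm_exp_ofReal_mul_ofReal_mul_I (s x : ℝ) : ‖exp (s * x * I)‖ = 1 := by
  rw [← ofReal_mul, norm_exp_ofReal_mul_I]

variable {κ Ω : Type*} [Fintype κ] [MeasurableSpace Ω] {P : Measure Ω} {N : κ → Finset κ}

lemma integrable_mul_exp_ofReal_mul_I {X Y : Ω → ℝ} (hX : Integrable X P) (hY : AEMeasurable Y P)
    (s : ℝ) : Integrable (fun ω => X ω * exp (s * Y ω * I)) P :=
  hX.ofReal.mul_bdd (by fun_prop) (.of_forall fun ω => (norm_exp_ofReal_mul_ofReal_mul_I _ _).le)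

lemma sum_mul_exp_sub_eq (N : κ → Finset κ) (x : κ → ℝ) (s : ℝ) :
    (∑ k, x k : ℝ) * exp (s * (∑ k, x k : ℝ) * I) - s * I * exp (s * (∑ k, x k : ℝ) * I) -
        ∑ k, x k * exp (s * (∑ l, x l - ∑ l ∈ N k, x l : ℝ) * I) =
      exp (s * (∑ k, x k : ℝ) * I) * (s * I * (localSq N x - 1 : ℝ) -
        ∑ k, x k * (exp ((-(s * ∑ l ∈ N k, x l) : ℝ) * I) - 1 -
          (-(s * ∑ l ∈ N k, x l) : ℝ) * I)) := by
  set W : ℝ := ∑ k, x k with hW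
  have hterm (k : κ) : x k * exp (s * (W - ∑ l ∈ N k, x l : ℝ) * I) =
      exp (s * W * I) * (x k - x k * ((s * ∑ l ∈ N k, x l : ℝ) * I) +
        x k * (exp ((-(s * ∑ l ∈ N k, x l) : ℝ) * I) - 1 -
          (-(s * ∑ l ∈ N k, x l) : ℝ) * I)) := by
    rw [show s * (W - ∑ l ∈ N k, x l : ℝ) * I = s * W * I + (-(s * ∑ l ∈ N k, x l) : ℝ) * I by
      push_cast; ring, exp_add, ofReal_neg]
    ring
  have hlocal : ∑ k, x k * ((s * ∑ l ∈ N k, x l : ℝ) * I) = s * I * (localSq N x : ℝ) := by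
    rw [localSq, ofReal_sum, mul_sum]
    exact sum_congr rfl fun k _ => by push_cast; ring
  rw [sum_congr rfl fun k _ => hterm k, ← mul_sum, sum_add_distrib, sum_sub_distrib, hlocal,
    ← ofReal_sum, ← hW, ofReal_sub, ofReal_one]
  ring

lemma norm_sum_mul_exp_sub_le (N : κ → Finset κ) (x : κ → ℝ) (s : ℝ) :
    ‖(∑ k, x k : ℝ) * exp (s * (∑ k, x k : ℝ) * I) - s * I * exp (s * (∑ k, x k : ℝ) * I) -
        ∑ k, x k * exp (s * (∑ l, x l - ∑ l ∈ N k, x l : ℝ) * I)‖ ≤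
      |s| * |localSq N x - 1| + 2 * s ^ 2 * ∑ k, |x k| * (∑ l ∈ N k, x l) ^ 2 := by
  rw [sum_mul_exp_sub_eq, norm_mul, norm_exp_ofReal_mul_ofReal_mul_I, one_mul]
  refine (norm_sub_le _ _).trans (add_le_add (by simp [← Real.norm_eq_abs, ← norm_real]) ?_)
  rw [mul_sum]
  refine (norm_sum_le _ _).trans (sum_le_sum fun k _ => ?_)
  rw [norm_mul, norm_real, Real.norm_eq_abs, mul_left_comm]
  refine mul_le_mul_of_nonneg_left ?_ (abs_nonneg _)
  exact (norm_exp_mul_I_sub_one_sub_le _).trans_eq (by ring)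

lemma sum_abs_mul_sq_sum_le {x : κ → ℝ} {B : ℝ} {D : ℕ} (hx : ∀ k, |x k| ≤ B)
    (hN : ∀ k, #(N k) ≤ D) :
    ∑ k, |x k| * (∑ l ∈ N k, x l) ^ 2 ≤ Fintype.card κ * D ^ 2 * B ^ 3 := by
  have hterm (k) : |x k| * (∑ l ∈ N k, x l) ^ 2 ≤ D ^ 2 * B ^ 3 := by
    have hB : 0 ≤ B := (abs_nonneg _).trans (hx k)
    have hsum : |∑ l ∈ N k, x l| ≤ D * B := calc
      |∑ l ∈ N k, x l| ≤ ∑ l ∈ N k, |x l| := abs_sum_le_sum_abs _ _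
      _ ≤ #(N k) • B := sum_le_card_nsmul _ _ _ fun l _ => hx l
      _ ≤ D * B := by rw [nsmul_eq_mul]; gcongr; exact hN k
    calc |x k| * (∑ l ∈ N k, x l) ^ 2 = |x k| * |∑ l ∈ N k, x l| ^ 2 := by rw [sq_abs]
      _ ≤ B * (D * B) ^ 2 := by gcongr; exact hx k
      _ = D ^ 2 * B ^ 3 := by ring
  calc _ ≤ ∑ _k : κ, D ^ 2 * B ^ 3 := sum_le_sum fun k _ => hterm k
    _ = _ := by rw [sum_const, card_univ, nsmul_eq_mul, mul_assoc]

lemma integral_abs_sub_integral_le_sqrt_variance [IsProbabilityMeasure P] {X : Ω → ℝ}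
    (hX : MemLp X 2 P) : ∫ ω, |X ω - P[X]| ∂P ≤ √Var[X; P] := by
  have hY : MemLp (fun ω => |X ω - P[X]|) 2 P := (hX.sub (memLp_const _)).abs
  refine Real.le_sqrt_of_sq_le ?_
  have := variance_nonneg (fun ω => |X ω - P[X]|) P
  rw [variance_eq_sub hY] at this
  simpa [variance_eq_integral hX.1.aemeasurable, sq_abs] using this

lemma norm_sub_exp_neg_smul_le {E : Type*} [NormedAddCommGroup E] [NormedSpace ℝ E]
    {φ : ℝ → E} (hφ : Differentiable ℝ φ) {t C : ℝ}
    (hC : ∀ s, |s| ≤ |t| → ‖deriv φ s + s • φ s‖ ≤ C) :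
    ‖φ t - Real.exp (-(t ^ 2 / 2)) • φ 0‖ ≤ C * |t| := by
  set e : ℝ → ℝ := fun s => Real.exp (s ^ 2 / 2)
  have he (s) : HasDerivAt e (e s * s) s := by
    simpa using (((hasDerivAt_id s).pow 2).div_const 2).exp
  have hψ : ∀ s ∈ Set.uIcc 0 t, HasDerivWithinAt (fun s => e s • φ s)
      (e s • (deriv φ s + s • φ s)) (Set.uIcc 0 t) s := fun s _ =>
    ((he s).smul (hφ s).hasDerivAt).hasDerivWithinAt.congr_deriv (by rw [smul_add, smul_smul])
  have hbound : ∀ s ∈ Set.uIcc 0 t, ‖e s • (deriv φ s + s • φ s)‖ ≤ e t * C := by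
    intro s hs
    have hst : |s| ≤ |t| := by simpa using Set.abs_sub_left_of_mem_uIcc hs
    rw [norm_smul, Real.norm_of_nonneg (Real.exp_pos _).le]
    exact mul_le_mul (Real.exp_le_exp.2 (by linarith [sq_le_sq.2 hst])) (hC s hst) (norm_nonneg _)
      (Real.exp_pos _).le
  have hmv := (convex_uIcc 0 t).norm_image_sub_le_of_norm_hasDerivWithin_le hψ hbound
    Set.left_mem_uIcc Set.right_mem_uIcc
  have hcancel : Real.exp (-(t ^ 2 / 2)) * e t = 1 := by rw [← Real.exp_add]; simp
  calc ‖φ t - Real.exp (-(t ^ 2 / 2)) • φ 0‖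
      = ‖Real.exp (-(t ^ 2 / 2)) • (e t • φ t - e 0 • φ 0)‖ := by
        rw [smul_sub, smul_smul, hcancel, one_smul]; simp [e]
    _ ≤ Real.exp (-(t ^ 2 / 2)) * (e t * C * ‖t - 0‖) := by
        rw [norm_smul, Real.norm_of_nonneg (Real.exp_pos _).le]; gcongr
    _ = C * |t| := by
        rw [sub_zero, Real.norm_eq_abs, ← mul_assoc, ← mul_assoc, hcancel, one_mul]

lemma deriv_charFun {μ : Measure ℝ} [IsFiniteMeasure μ] (hμ : MemLp id 1 μ) (s : ℝ) :
    deriv (charFun μ) s = I * ∫ x, x * exp (s * x * I) ∂μ := by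
  have := iteratedDeriv_charFun (n := 1) (t := s) (by simpa using hμ)
  simpa using this

lemma memLp_id_map_sum_of_abs_le [IsFiniteMeasure P] {ξ : κ → Ω → ℝ} {B : ℝ} {p : ENNReal}
    (hξ : ∀ k, AEMeasurable (ξ k) P) (hB : ∀ k, ∀ᵐ ω ∂P, |ξ k ω| ≤ B) :
    MemLp id p (P.map fun ω => ∑ k, ξ k ω) :=
  (memLp_map_measure_iff (by fun_prop) (by fun_prop)).2 <| memLp_finsetSum _ fun k _ =>
    .of_bound (hξ k).aestronglyMeasurable B (hB k)

namespace HasDependencyNbhds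

variable {ξ : κ → Ω → ℝ} {B : ℝ} {D : ℕ}

lemma indepFun_sub_sum_nbhd [IsProbabilityMeasure P] (h : HasDependencyNbhds ξ N P) (k : κ) :
    IndepFun (ξ k) (fun ω => ∑ l, ξ l ω - ∑ l ∈ N k, ξ l ω) P := by
  classical
  have hcompl : ∀ x : κ → ℝ, ∑ l, x l - ∑ l ∈ N k, x l = ∑ l ∈ (N k)ᶜ, x l := fun x =>
    sub_eq_of_eq_add' (sum_add_sum_compl _ _).symm
  simp only [hcompl]
  refine indepFun_of_dependsOn (X := ξ) (f := fun x => x k) (g := fun x => ∑ l ∈ (N k)ᶜ, x l)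
    (h.indepFun {k} (N k)ᶜ ?_) (by fun_prop) (by fun_prop)
    (fun x y hxy => hxy k (mem_coe.2 (mem_singleton_self k)))
    (fun x y hxy => sum_congr rfl fun l hl => hxy l (mem_coe.2 hl))
  exact fun j hj => by rw [mem_singleton.1 hj]; exact disjoint_compl_right

lemma integral_mul_exp_sub_sum_nbhd [IsProbabilityMeasure P] (h : HasDependencyNbhds ξ N P)
    (hξ : ∀ k, AEMeasurable (ξ k) P) {k : κ} (h0 : P[ξ k] = 0) (s : ℝ) :
    ∫ ω, ξ k ω * exp (s * (∑ l, ξ l ω - ∑ l ∈ N k, ξ l ω : ℝ) * I) ∂P = 0 := by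
  have hind := (h.indepFun_sub_sum_nbhd k).comp (φ := fun x : ℝ => (x : ℂ))
    (ψ := fun x : ℝ => exp (s * x * I)) (by fun_prop) (by fun_prop)
  refine (hind.integral_fun_mul_eq_mul_integral (by fun_prop) (by fun_prop)).trans ?_
  simp only [Function.comp_apply, integral_complex_ofReal, h0, ofReal_zero, zero_mul]

lemma norm_integral_mul_exp_sub_le [IsProbabilityMeasure P] (h : HasDependencyNbhds ξ N P)
    (hξ : ∀ k, AEMeasurable (ξ k) P) (hB : ∀ k, ∀ᵐ ω ∂P, |ξ k ω| ≤ B) (hN : ∀ k, #(N k) ≤ D)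
    (h0 : ∀ k, P[ξ k] = 0) (s : ℝ) :
    ‖∫ ω, (∑ k, ξ k ω : ℝ) * exp (s * (∑ k, ξ k ω : ℝ) * I) ∂P -
        s * I * ∫ ω, exp (s * (∑ k, ξ k ω : ℝ) * I) ∂P‖ ≤
      |s| * ∫ ω, |localSq N (fun k => ξ k ω) - 1| ∂P +
        2 * s ^ 2 * (Fintype.card κ * D ^ 2 * B ^ 3) := by
  have hL (k) : MemLp (ξ k) ⊤ P := .of_bound (hξ k).aestronglyMeasurable B (hB k)
  set W : Ω → ℝ := fun ω => ∑ k, ξ k ω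
  have hWint : Integrable W P := integrable_finsetSum univ fun k _ => (hL k).integrable le_top
  have hW := integrable_mul_exp_ofReal_mul_I hWint hWint.aemeasurable s
  have hexp : Integrable (fun ω => s * I * exp (s * W ω * I)) P := by
    simpa using (integrable_mul_exp_ofReal_mul_I (integrable_const 1) hWint.aemeasurable s
      ).const_mul (s * I)
  have hdiff : Integrable (fun ω => W ω * exp (s * W ω * I) - s * I * exp (s * W ω * I)) P :=
    hW.sub hexp
  have hterm (k) := integrable_mul_exp_ofReal_mul_I ((hL k).integrable le_top)
    (Y := fun ω => W ω - ∑ l ∈ N k, ξ l ω) (by fun_prop) s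
  have hQ : Integrable (fun ω => |localSq N (fun k => ξ k ω) - 1|) P :=
    (((memLp_top_localSq hL N).integrable le_top).sub (integrable_const 1)).abs
  have hinsert : ∫ ω, W ω * exp (s * W ω * I) ∂P - s * I * ∫ ω, exp (s * W ω * I) ∂P =
      ∫ ω, (W ω * exp (s * W ω * I) - s * I * exp (s * W ω * I) -
        ∑ k, ξ k ω * exp (s * (W ω - ∑ l ∈ N k, ξ l ω : ℝ) * I)) ∂P := by
    rw [integral_sub hdiff (integrable_finsetSum _ fun k _ => hterm k), integral_sub hW hexp,
      integral_const_mul, integral_finsetSum _ fun k _ => hterm k,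
      sum_eq_zero fun k _ => h.integral_mul_exp_sub_sum_nbhd hξ (h0 k) s, sub_zero]
  rw [hinsert]
  calc _ ≤ ∫ ω, (|s| * |localSq N (fun k => ξ k ω) - 1| +
        2 * s ^ 2 * (Fintype.card κ * D ^ 2 * B ^ 3)) ∂P := by
        refine norm_integral_le_of_norm_le ((hQ.const_mul _).add (integrable_const _)) ?_
        filter_upwards [ae_all_iff.2 hB] with ω hω
        refine (norm_sum_mul_exp_sub_le N (fun k => ξ k ω) s).trans ?_
        gcongr
        exact sum_abs_mul_sq_sum_le hω hN
    _ = _ := by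
        rw [integral_add (hQ.const_mul _) (integrable_const _), integral_const_mul]
        simp

lemma integral_abs_localSq_sub_one_le [IsProbabilityMeasure P] (h : HasDependencyNbhds ξ N P)
    (hξ : ∀ k, AEMeasurable (ξ k) P) (hB : ∀ k, ∀ᵐ ω ∂P, |ξ k ω| ≤ B) (hN : ∀ k, #(N k) ≤ D)
    (h0 : ∀ k, P[ξ k] = 0) (h1 : Var[fun ω => ∑ k, ξ k ω; P] = 1) :
    ∫ ω, |localSq N (fun k => ξ k ω) - 1| ∂P ≤ 2 * (Fintype.card κ * D ^ 2 * B ^ 3) := by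
  have hL (k) : MemLp (ξ k) ⊤ P := .of_bound (hξ k).aestronglyMeasurable B (hB k)
  have hmean : ∫ ω, localSq N (fun k => ξ k ω) ∂P = 1 := by
    rw [h.integral_localSq (fun k => (hL k).mono_exponent le_top) h0, ← h1,
      variance_of_integral_eq_zero (by fun_prop)]
    rw [integral_finsetSum _ fun k _ => (hL k).integrable le_top, sum_eq_zero fun k _ => h0 k]
  have hn : 1 ≤ Fintype.card κ * D * B ^ 2 := h1 ▸ h.variance_sum_le hξ hB hN
  have hB0 : 0 ≤ B := by
    obtain ⟨k⟩ : Nonempty κ := not_isEmpty_iff.1 fun _ => by simp [localSq] at hmean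
    obtain ⟨ω, hω⟩ := (hB k).exists
    exact (abs_nonneg _).trans hω
  calc ∫ ω, |localSq N (fun k => ξ k ω) - 1| ∂P
      ≤ √Var[fun ω => localSq N fun k => ξ k ω; P] := by
        simpa only [hmean] using integral_abs_sub_integral_le_sqrt_variance
          ((memLp_top_localSq hL N).mono_exponent le_top)
    _ ≤ 2 * (Fintype.card κ * D ^ 2 * B ^ 3) := by
        refine Real.sqrt_le_iff.2 ⟨by positivity, (h.variance_localSq_le hξ hB hN).trans ?_⟩
        calc 4 * Fintype.card κ * D ^ 3 * B ^ 4
            ≤ 4 * Fintype.card κ * D ^ 3 * B ^ 4 * (Fintype.card κ * D * B ^ 2) :=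
              le_mul_of_one_le_right (by positivity) hn
          _ = (2 * (Fintype.card κ * D ^ 2 * B ^ 3)) ^ 2 := by ring

lemma norm_deriv_charFun_add_le [IsProbabilityMeasure P] (h : HasDependencyNbhds ξ N P)
    (hξ : ∀ k, AEMeasurable (ξ k) P) (hB : ∀ k, ∀ᵐ ω ∂P, |ξ k ω| ≤ B) (hN : ∀ k, #(N k) ≤ D)
    (h0 : ∀ k, P[ξ k] = 0) (h1 : Var[fun ω => ∑ k, ξ k ω; P] = 1) (s : ℝ) :
    ‖deriv (charFun (P.map fun ω => ∑ k, ξ k ω)) s +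
        s • charFun (P.map fun ω => ∑ k, ξ k ω) s‖ ≤
      2 * (Fintype.card κ * D ^ 2 * B ^ 3) * (|s| + s ^ 2) := by
  have hW : AEMeasurable (fun ω => ∑ k, ξ k ω) P := by fun_prop
  have := Measure.isProbabilityMeasure_map hW
  have hmem := memLp_id_map_sum_of_abs_le hξ hB (p := 1)
  have hstein := h.norm_integral_mul_exp_sub_le hξ hB hN h0 s
  rw [deriv_charFun hmem, charFun_apply_real, integral_map hW (by fun_prop),
    integral_map hW (by fun_prop)]
  calc _ = ‖I * (∫ ω, (∑ k, ξ k ω : ℝ) * exp (s * (∑ k, ξ k ω : ℝ) * I) ∂P -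
        s * I * ∫ ω, exp (s * (∑ k, ξ k ω : ℝ) * I) ∂P)‖ := by
        rw [real_smul, mul_sub, ← mul_assoc I, mul_left_comm I, I_mul_I, mul_neg_one, neg_mul,
          sub_neg_eq_add]
    _ ≤ |s| * (2 * (Fintype.card κ * D ^ 2 * B ^ 3)) +
        2 * s ^ 2 * (Fintype.card κ * D ^ 2 * B ^ 3) := by
        rw [norm_mul, norm_I, one_mul]
        exact hstein.trans (by gcongr; exact h.integral_abs_localSq_sub_one_le hξ hB hN h0 h1)
    _ = 2 * (Fintype.card κ * D ^ 2 * B ^ 3) * (|s| + s ^ 2) := by ring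

lemma norm_charFun_sub_gaussian_le_of_variance_eq_one [IsProbabilityMeasure P]
    (h : HasDependencyNbhds ξ N P) (hξ : ∀ k, AEMeasurable (ξ k) P)
    (hB : ∀ k, ∀ᵐ ω ∂P, |ξ k ω| ≤ B) (hN : ∀ k, #(N k) ≤ D) (h0 : ∀ k, P[ξ k] = 0)
    (h1 : Var[fun ω => ∑ k, ξ k ω; P] = 1) (t : ℝ) :
    ‖charFun (P.map fun ω => ∑ k, ξ k ω) t - charFun (gaussianReal 0 1) t‖ ≤
      2 * (Fintype.card κ * D ^ 2 * B ^ 3) * (t ^ 2 + |t| ^ 3) := by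
  have hW : AEMeasurable (fun ω => ∑ k, ξ k ω) P := by fun_prop
  have := Measure.isProbabilityMeasure_map hW
  have hmem := memLp_id_map_sum_of_abs_le hξ hB (p := 1)
  have hdiff : Differentiable ℝ (charFun (P.map fun ω => ∑ k, ξ k ω)) :=
    (contDiff_charFun (n := 1) (by simpa using hmem)).differentiable one_ne_zero
  have hode : ∀ s, |s| ≤ |t| → ‖deriv (charFun (P.map fun ω => ∑ k, ξ k ω)) s +
      s • charFun (P.map fun ω => ∑ k, ξ k ω) s‖ ≤
      2 * (Fintype.card κ * D ^ 2 * B ^ 3) * (|t| + t ^ 2) := by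
    intro s hs
    have hB3 : 0 ≤ 2 * (Fintype.card κ * D ^ 2 * B ^ 3) :=
      (integral_nonneg fun _ => abs_nonneg _).trans
        (h.integral_abs_localSq_sub_one_le hξ hB hN h0 h1)
    refine (h.norm_deriv_charFun_add_le hξ hB hN h0 h1 s).trans ?_
    exact mul_le_mul_of_nonneg_left (add_le_add hs (sq_le_sq.2 hs)) hB3
  calc ‖charFun (P.map fun ω => ∑ k, ξ k ω) t - charFun (gaussianReal 0 1) t‖
      = ‖charFun (P.map fun ω => ∑ k, ξ k ω) t -
          Real.exp (-(t ^ 2 / 2)) • charFun (P.map fun ω => ∑ k, ξ k ω) 0‖ := by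
        simp [charFun_gaussianReal]
    _ ≤ 2 * (Fintype.card κ * D ^ 2 * B ^ 3) * (|t| + t ^ 2) * |t| :=
        norm_sub_exp_neg_smul_le hdiff hode
    _ = 2 * (Fintype.card κ * D ^ 2 * B ^ 3) * (t ^ 2 + |t| ^ 3) := by
        rw [← sq_abs t]; ring

lemma norm_charFun_sub_gaussian_le [IsProbabilityMeasure P]
    (h : HasDependencyNbhds ξ N P) (hξ : ∀ k, AEMeasurable (ξ k) P)
    (hB : ∀ k, ∀ᵐ ω ∂P, |ξ k ω| ≤ B) (hN : ∀ k, #(N k) ≤ D) {σ : ℝ} (hσ : 0 < σ)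
    (hv : Var[fun ω => ∑ k, ξ k ω; P] = σ ^ 2) (t : ℝ) :
    ‖charFun (P.map fun ω => (∑ k, ξ k ω - ∫ ω, ∑ k, ξ k ω ∂P) / σ) t -
        charFun (gaussianReal 0 1) t‖ ≤
      16 * (Fintype.card κ * D ^ 2 * (B / σ) ^ 3) * (t ^ 2 + |t| ^ 3) := by
  have h_int (k) : Integrable (ξ k) P := .of_bound (hξ k).aestronglyMeasurable B (hB k)
  have hstd (ω) : (∑ k, ξ k ω - ∫ ω, ∑ k, ξ k ω ∂P) / σ = ∑ k, (ξ k ω - P[ξ k]) / σ := by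
    rw [integral_finsetSum _ fun k _ => h_int k, ← sum_sub_distrib, sum_div]
  have hmean (k) : ∫ ω, (ξ k ω - P[ξ k]) / σ ∂P = 0 := by
    rw [integral_div, integral_sub (h_int k) (integrable_const _), integral_const]
    simp
  have hvar : Var[fun ω => ∑ k, (ξ k ω - P[ξ k]) / σ; P] = 1 := by
    simp_rw [← hstd, div_eq_mul_inv]
    rw [variance_mul_const, variance_sub_const (by fun_prop), hv, inv_pow,
      mul_inv_cancel₀ (pow_pos hσ 2).ne']
  have hbound (k) : ∀ᵐ ω ∂P, |(ξ k ω - P[ξ k]) / σ| ≤ 2 * (B / σ) := by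
    have hE : |P[ξ k]| ≤ B := by
      simpa using norm_integral_le_of_norm_le_const (f := ξ k) (hB k)
    filter_upwards [hB k] with ω hω
    rw [abs_div, abs_of_pos hσ, ← mul_div_assoc, two_mul]
    gcongr
    exact (abs_sub _ _).trans (add_le_add hω hE)
  have hcomp : HasDependencyNbhds (fun k ω => (ξ k ω - P[ξ k]) / σ) N P :=
    h.comp (φ := fun k x => (x - P[ξ k]) / σ) fun k => by fun_prop
  have hmain := hcomp.norm_charFun_sub_gaussian_le_of_variance_eq_one (fun k => by fun_prop)
    hbound hN hmean hvar t
  simp only [hstd]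
  exact hmain.trans_eq (by ring)

end HasDependencyNbhds

lemma tendstoInDistribution_of_hasDependencyNbhds {κ Ω : ℕ → Type*} [∀ m, Fintype (κ m)]
    [∀ m, MeasurableSpace (Ω m)] {P : ∀ m, Measure (Ω m)} [∀ m, IsProbabilityMeasure (P m)]
    {ξ : ∀ m, κ m → Ω m → ℝ} {N : ∀ m, κ m → Finset (κ m)} {B : ℕ → ℝ} {D : ℕ → ℕ}
    (h : ∀ m, HasDependencyNbhds (ξ m) (N m) (P m)) (hξ : ∀ m k, AEMeasurable (ξ m k) (P m))
    (hB : ∀ m k, ∀ᵐ ω ∂P m, |ξ m k ω| ≤ B m) (hN : ∀ m k, #(N m k) ≤ D m) {σ : ℕ → ℝ}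
    (hσ : ∀ᶠ m in atTop, 0 < σ m) (hv : ∀ m, Var[fun ω => ∑ k, ξ m k ω; P m] = σ m ^ 2)
    (hlim : Tendsto (fun m => Fintype.card (κ m) * D m ^ 2 * (B m / σ m) ^ 3) atTop (𝓝 0)) :
    TendstoInDistribution
      (fun m ω => (∑ k, ξ m k ω - ∫ ω, ∑ k, ξ m k ω ∂P m) / σ m) atTop id P
      (gaussianReal 0 1) := by
  refine ⟨fun m => by fun_prop, aemeasurable_id,
    ProbabilityMeasure.tendsto_iff_tendsto_charFun.2 fun t => ?_⟩
  simp only [ProbabilityMeasure.coe_mk, Measure.map_id]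
  rw [tendsto_iff_norm_sub_tendsto_zero]
  refine squeeze_zero' (.of_forall fun m => norm_nonneg _) ?_
    (by simpa using (hlim.const_mul 16).mul_const (t ^ 2 + |t| ^ 3))
  filter_upwards [hσ] with m hm
  exact (h m).norm_charFun_sub_gaussian_le (hξ m) (hB m) (hN m) hm (hv m) t

end SteinMethod

lemma bit_nonneg (b : Bool) : 0 ≤ bit b := by cases b <;> simp [bit]

lemma bit_le_one (b : Bool) : bit b ≤ 1 := by cases b <;> simp [bit]

lemma bit_mul_self (b : Bool) : bit b * bit b = bit b := by cases b <;> simp [bit]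

lemma dependsOn_bit {ι : Type*} {s : Set ι} {r : ι} (hr : r ∈ s) :
    DependsOn (fun t : ι → Bool => bit (t r)) s :=
  fun _ _ h => congrArg bit (h r hr)

lemma dependsOn_sum_bit_mul {ι : Type*} [Fintype ι] {f : ι → ℝ} {s : Set ι}
    (h : ∀ r, r ∉ s → f r = 0) : DependsOn (fun t : ι → Bool => ∑ r, bit (t r) * f r) s := by
  intro t t' htt'
  refine Finset.sum_congr rfl fun r _ => ?_
  by_cases hr : r ∈ s
  · rw [htt' r hr]
  · rw [h r hr, mul_zero, mul_zero]

lemma dependsOn_comp {ι E F : Type*} {β : ι → Type*} {f : (∀ i, β i) → E} {s : Set ι}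
    (hf : DependsOn f s) (g : E → F) : DependsOn (fun t => g (f t)) s :=
  fun _ _ h => congrArg g (hf h)

lemma dependsOn_comp₂ {ι E E' F : Type*} {β : ι → Type*} {f : (∀ i, β i) → E}
    {f' : (∀ i, β i) → E'} {s : Set ι} (hf : DependsOn f s) (hf' : DependsOn f' s)
    (g : E → E' → F) : DependsOn (fun t => g (f t) (f' t)) s :=
  fun _ _ h => congrArg₂ g (hf h) (hf' h)

namespace UnipartiteExperiment

variable {ι Ω : Type*} [MeasurableSpace Ω] {P : Measure Ω} {p : ℝ} {T : Ω → ι → Bool}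

namespace IsBernoulliDesign

section Finite

variable [Finite ι] [IsProbabilityMeasure P]

lemma memLp {E : Type*} [NormedAddCommGroup E] (h : IsBernoulliDesign P p T) (f : (ι → Bool) → E)
    (q : ENNReal) : MemLp (fun ω => f (T ω)) q P := by
  obtain ⟨C, hC⟩ := (Set.finite_range fun t => ‖f t‖).bddAbove
  refine MemLp.of_bound ?_ C (ae_of_all _ fun ω => hC ⟨T ω, rfl⟩)
  exact ((StronglyMeasurable.of_discrete (f := f)).comp_measurable
    (measurable_pi_lambda _ h.measurable)).aestronglyMeasurable

lemma integrable {E : Type*} [NormedAddCommGroup E] (h : IsBernoulliDesign P p T)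
    (f : (ι → Bool) → E) : Integrable (fun ω => f (T ω)) P :=
  memLp_one_iff_integrable.1 (h.memLp f 1)

lemma indepFun {E F : Type*} [MeasurableSpace E] [MeasurableSpace F]
    (h : IsBernoulliDesign P p T) {f : (ι → Bool) → E} {g : (ι → Bool) → F} {s s' : Set ι}
    (hs : Disjoint s s') (hf : DependsOn f s) (hg : DependsOn g s') :
    IndepFun (fun ω => f (T ω)) (fun ω => g (T ω)) P := by
  obtain ⟨S, rfl⟩ := s.toFinite.exists_finset_coe
  obtain ⟨S', rfl⟩ := s'.toFinite.exists_finset_coe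
  exact indepFun_of_dependsOn
    (h.indep.indepFun_finset S S' (Finset.disjoint_coe.1 hs) h.measurable)
    .of_discrete .of_discrete hf hg

lemma integral_mul (h : IsBernoulliDesign P p T) {f g : (ι → Bool) → ℝ} {s s' : Set ι}
    (hs : Disjoint s s') (hf : DependsOn f s) (hg : DependsOn g s') :
    ∫ ω, f (T ω) * g (T ω) ∂P = (∫ ω, f (T ω) ∂P) * ∫ ω, g (T ω) ∂P :=
  (h.indepFun hs hf hg).integral_fun_mul_eq_mul_integral (h.integrable f).1 (h.integrable g).1

end Finite

lemma integral_bit (h : IsBernoulliDesign P p T) (r : ι) : ∫ ω, bit (T ω r) ∂P = p := by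
  have hm : MeasurableSet {ω | T ω r = true} := h.measurable r (measurableSet_singleton true)
  have hind : (fun ω => bit (T ω r)) = {ω | T ω r = true}.indicator 1 := by
    funext ω
    by_cases hω : T ω r = true <;> simp [bit, hω]
  rw [hind, integral_indicator_one hm, h.prob r]

variable [IsProbabilityMeasure P]

lemma integral_bit_mul [Finite ι] (h : IsBernoulliDesign P p T) {r : ι} {f : (ι → Bool) → ℝ}
    (hf : DependsOn f {r}ᶜ) : ∫ ω, bit (T ω r) * f (T ω) ∂P = p * ∫ ω, f (T ω) ∂P := by
  rw [h.integral_mul disjoint_compl_right (dependsOn_bit (Set.mem_singleton r)) hf, h.integral_bit]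

lemma covariance_bit [Finite ι] [DecidableEq ι] (h : IsBernoulliDesign P p T) (r s : ι) :
    cov[fun ω => bit (T ω r), fun ω => bit (T ω s); P] = if r = s then p * (1 - p) else 0 := by
  have hL (r) : MemLp (fun ω => bit (T ω r)) 2 P := h.memLp (fun t => bit (t r)) 2
  split_ifs with hrs
  · subst hrs
    rw [covariance_eq_sub (hL r) (hL r)]
    simp only [Pi.mul_apply, bit_mul_self, h.integral_bit]
    ring
  · exact (h.indepFun (Set.disjoint_singleton.2 hrs) (dependsOn_bit (Set.mem_singleton r))
      (dependsOn_bit (Set.mem_singleton s))).covariance_eq_zero (hL r) (hL s)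

variable [Fintype ι]

lemma integral_sum_bit_mul (h : IsBernoulliDesign P p T) (f : ι → ℝ) :
    ∫ ω, ∑ r, bit (T ω r) * f r ∂P = p * ∑ r, f r := by
  rw [integral_finsetSum _ fun r _ => h.integrable fun t => bit (t r) * f r, Finset.mul_sum]
  simp only [integral_mul_const, h.integral_bit]

lemma covariance_sum_bit_mul (h : IsBernoulliDesign P p T) (f g : ι → ℝ) :
    cov[fun ω => ∑ r, bit (T ω r) * f r, fun ω => ∑ r, bit (T ω r) * g r; P] =
      p * (1 - p) * ∑ r, f r * g r := by
  classical
  rw [covariance_fun_sum_fun_sum (fun r => h.memLp (fun t => bit (t r) * f r) 2)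
    (fun r => h.memLp (fun t => bit (t r) * g r) 2), Finset.mul_sum]
  refine Finset.sum_congr rfl fun r _ => ?_
  simp only [covariance_mul_const_left, covariance_mul_const_right, h.covariance_bit, ite_mul,
    zero_mul, Finset.sum_ite_eq, Finset.mem_univ, if_true]
  ring

end IsBernoulliDesign

/-- The indicator of `E_{ar}(1) = 1`. -/
def fullEdge (X : UnipartiteExperiment ι) (a r : ι) : ℝ := bit (X.E a r fun _ => true)

/-- The set of `r ≠ a` with `(a, r) ∈ G`. The instrument of `a` depends on the treatments in this
set only, and everything in the estimator that is not the effect of an anchor edge depends on the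
other treatments only. -/
def anchorNbrs (X : UnipartiteExperiment ι) (a : ι) : Set ι := {r | (a, r) ∈ X.G ∧ r ≠ a}

variable [Fintype ι]

/-- The covariance of exposure and instrument, up to the factor `p (1 - p)`. -/
def instrumentStrength (X : UnipartiteExperiment ι) (a : ι) : ℝ := ∑ r, X.w a r * X.u a r

/-- `z_a - 𝔼 z_a` as a function of the treatment assignment. -/
def centeredInstrument (X : UnipartiteExperiment ι) (p : ℝ) (a : ι) (t : ι → Bool) : ℝ :=
  X.instrument a t - p * ∑ r, X.u a r

/-- `β̂_a` as a function of the treatment assignment. -/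
noncomputable def slopeEstimate (X : UnipartiteExperiment ι) (p : ℝ) (a : ι) (t : ι → Bool) : ℝ :=
  X.outcome a t * X.centeredInstrument p a t / (p * (1 - p) * X.instrumentStrength a)

/-- The summand of `μ̂_uni` that belongs to the unit `a`, as a function of the treatment
assignment. The assignment is passed to `weightHat` and `gammaHat` as the identity map, that is
with the space of assignments as sample space. -/
noncomputable def contribution (X : UnipartiteExperiment ι) (p : ℝ) (a : ι) (t : ι → Bool) : ℝ :=
  (1 / (Fintype.card ι : ℝ)) * (X.slopeEstimate p a t * X.weightHat p id a t + X.gammaHat p id a t)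

/-- The part `∑_r t_r c_{ar} w_{ar}` of the exposure that goes through the anchor edges. -/
def anchorExposure (X : UnipartiteExperiment ι) (a : ι) (t : ι → Bool) : ℝ :=
  ∑ r, bit (t r) * (X.c a r * X.w a r)

/-- The outcome without the effect of the exposure through the anchor edges. -/
def residualOutcome (X : UnipartiteExperiment ι) (a : ι) (t : ι → Bool) : ℝ :=
  X.outcome a t - X.β a * X.anchorExposure a t

open Classical in
/-- The set `R_a ∪ {a}` of the units on whose treatments the contribution of `a` depends. -/
noncomputable def relevantUnits (X : UnipartiteExperiment ι) (a : ι) : Finset ι :=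
  insert a (X.outNbrs a)

/-- The constant `K` with `|β̂_a Ŵ_a + γ̂_a| ≤ K d_A`: the first summand comes from `β̂_a Ŵ_a`, the
second one from `γ̂_a`. -/
noncomputable def estimatorBound (p₀ Wl Wh M : ℝ) : ℝ := M * Wh / (p₀ ^ 3 * Wl) + M / p₀

variable {X : UnipartiteExperiment ι} {a r : ι}

lemma mem_relevantUnits : r ∈ X.relevantUnits a ↔ r = a ∨ r ∈ X.outNbrs a := by
  simp [relevantUnits]

lemma fullEdge_eq_one_of_mem (h : r ∈ X.outNbrs a) : X.fullEdge a r = 1 := by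
  simp_all [outNbrs, fullEdge, bit]

lemma fullEdge_eq_zero (h : r ∉ X.outNbrs a) : X.fullEdge a r = 0 := by
  simp_all [outNbrs, fullEdge, bit]

lemma exposure_false (X : UnipartiteExperiment ι) (a : ι) : X.exposure a (fun _ => false) = 0 := by
  simp [exposure, bit]

lemma card_outNbrs_le_dA (X : UnipartiteExperiment ι) (a : ι) : (X.outNbrs a).card ≤ X.dA :=
  Finset.le_sup (f := fun a => (X.outNbrs a).card) (Finset.mem_univ a)

lemma card_inNbrs_le_dR (X : UnipartiteExperiment ι) (r : ι) : (X.inNbrs r).card ≤ X.dR :=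
  Finset.le_sup (f := fun r => (X.inNbrs r).card) (Finset.mem_univ r)

lemma card_overlapNbhd_relevantUnits_le (X : UnipartiteExperiment ι) (a : ι) :
    (overlapNbhd X.relevantUnits a).card ≤ (X.dA + 1) * (X.dR + 1) := by
  classical
  have hsub : overlapNbhd X.relevantUnits a ⊆
      (X.relevantUnits a).biUnion fun r => insert r (X.inNbrs r) := by
    intro b hb
    obtain ⟨r, hra, hrb⟩ := Finset.not_disjoint_iff.1 (mem_overlapNbhd.1 hb)
    refine Finset.mem_biUnion.2 ⟨r, hra, Finset.mem_insert.2 ?_⟩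
    simpa only [inNbrs, outNbrs, Finset.mem_filter, Finset.mem_univ, true_and, eq_comm] using
      mem_relevantUnits.1 hrb
  have hout : (X.relevantUnits a).card ≤ X.dA + 1 := by
    rw [relevantUnits]
    exact (Finset.card_insert_le _ _).trans (Nat.add_le_add_right (X.card_outNbrs_le_dA a) 1)
  have hin (r) : (insert r (X.inNbrs r)).card ≤ X.dR + 1 :=
    (Finset.card_insert_le _ _).trans (Nat.add_le_add_right (X.card_inNbrs_le_dR r) 1)
  calc (overlapNbhd X.relevantUnits a).card
      ≤ ((X.relevantUnits a).biUnion fun r => insert r (X.inNbrs r)).card :=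
        Finset.card_le_card hsub
    _ ≤ (X.relevantUnits a).card * (X.dR + 1) :=
        Finset.card_biUnion_le_card_mul _ _ _ fun r _ => hin r
    _ ≤ (X.dA + 1) * (X.dR + 1) := Nat.mul_le_mul_right _ hout

section Moments

variable [IsProbabilityMeasure P]

lemma integral_instrument (h : IsBernoulliDesign P p T) (a : ι) :
    ∫ ω, X.instrument a (T ω) ∂P = p * ∑ r, X.u a r :=
  h.integral_sum_bit_mul _

lemma integral_centeredInstrument (h : IsBernoulliDesign P p T) (a : ι) :
    ∫ ω, X.centeredInstrument p a (T ω) ∂P = 0 := by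
  simp only [centeredInstrument]
  rw [integral_sub (h.integrable (X.instrument a)) (integrable_const _), integral_instrument h]
  simp

lemma integral_mul_centeredInstrument (h : IsBernoulliDesign P p T) (a : ι) (f : (ι → Bool) → ℝ) :
    ∫ ω, f (T ω) * X.centeredInstrument p a (T ω) ∂P =
      cov[fun ω => f (T ω), fun ω => X.instrument a (T ω); P] := by
  simp only [centeredInstrument, mul_sub]
  rw [covariance_eq_sub (h.memLp f 2) (h.memLp (X.instrument a) 2), integral_instrument h,
    integral_sub (h.integrable fun t => f t * X.instrument a t)
      (h.integrable fun t => f t * (p * ∑ r, X.u a r)), integral_mul_const]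
  rfl

end Moments

namespace Assumptions

variable {Wl Wh M p₀ : ℝ}

section Anchor

variable (A : X.Assumptions Wl Wh M)
include A

lemma fullEdge_eq_one (h : (a, r) ∈ X.G) : X.fullEdge a r = 1 := by
  simp [fullEdge, bit, A.anchor a r h]

lemma mem_outNbrs (h : (a, r) ∈ X.G) : r ∈ X.outNbrs a := by
  simp [outNbrs, A.anchor a r h]

lemma c_of_mem (h : (a, r) ∈ X.G) : X.c a r = 1 := by
  simp [A.c_eq, h]

lemma c_of_notMem (h : (a, r) ∉ X.G) : X.c a r = 0 := by
  simp [A.c_eq, h]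

lemma mem_anchorNbrs (h : X.u a r ≠ 0) : r ∈ X.anchorNbrs a :=
  ⟨A.u_support a r h, fun hra => h (hra ▸ A.u_self a)⟩

lemma fullEdge_mul_u (a r : ι) : X.fullEdge a r * X.u a r = X.u a r := by
  by_cases h : X.u a r = 0
  · rw [h, mul_zero]
  · rw [A.fullEdge_eq_one (A.u_support a r h), one_mul]

lemma c_mul_u (a r : ι) : X.c a r * X.u a r = X.u a r := by
  by_cases h : X.u a r = 0
  · rw [h, mul_zero]
  · rw [A.c_of_mem (A.u_support a r h), one_mul]

lemma bit_mul_bit (a r : ι) (t : ι → Bool) :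
    bit (t r) * bit (X.E a r t) = bit (t r) * X.fullEdge a r := by
  cases h : t r
  · simp [bit]
  · rw [fullEdge, A.r_driven a r t (fun _ => true) (by simpa using h)]

lemma exposure_eq (a : ι) (t : ι → Bool) :
    X.exposure a t = ∑ r, bit (t r) * (X.fullEdge a r * X.w a r) :=
  Finset.sum_congr rfl fun r _ => by rw [A.bit_mul_bit, mul_assoc]

lemma weightHat_eq {Ω' : Type*} (p : ℝ) (T : Ω' → ι → Bool) (a : ι) (ω : Ω') :
    X.weightHat p T a ω = ∑ r, bit (T ω r) * (X.w a r * (X.fullEdge a r - X.c a r) / p) +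
      ∑ r, X.w a r * X.c a r := by
  rw [weightHat, ← Finset.sum_add_distrib]
  refine Finset.sum_congr rfl fun r _ => ?_
  linear_combination (X.w a r / p) * A.bit_mul_bit a r (T ω)

lemma residualOutcome_eq (a : ι) (t : ι → Bool) :
    X.residualOutcome a t = X.α a +
      X.β a * ∑ r, bit (t r) * ((X.fullEdge a r - X.c a r) * X.w a r) + X.γ a * bit (t a) := by
  have hsplit : X.exposure a t =
      X.anchorExposure a t + ∑ r, bit (t r) * ((X.fullEdge a r - X.c a r) * X.w a r) := by
    rw [A.exposure_eq, anchorExposure, ← Finset.sum_add_distrib]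
    exact Finset.sum_congr rfl fun r _ => by ring
  rw [residualOutcome, outcome, hsplit]
  ring

lemma covariance_exposure_instrument [IsProbabilityMeasure P] (h : IsBernoulliDesign P p T)
    (a : ι) : cov[fun ω => X.exposure a (T ω), fun ω => X.instrument a (T ω); P] =
      p * (1 - p) * X.instrumentStrength a := by
  simp only [A.exposure_eq, instrument, h.covariance_sum_bit_mul, instrumentStrength]
  congr 1
  exact Finset.sum_congr rfl fun r _ => by linear_combination X.w a r * A.fullEdge_mul_u a r

lemma covariance_anchorExposure_instrument [IsProbabilityMeasure P] (h : IsBernoulliDesign P p T)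
    (a : ι) : cov[fun ω => X.anchorExposure a (T ω), fun ω => X.instrument a (T ω); P] =
      p * (1 - p) * X.instrumentStrength a := by
  simp only [anchorExposure, instrument, h.covariance_sum_bit_mul, instrumentStrength]
  congr 1
  exact Finset.sum_congr rfl fun r _ => by linear_combination X.w a r * A.c_mul_u a r

lemma muHat_eq [IsProbabilityMeasure P] (h : IsBernoulliDesign P p T) :
    X.muHat P p T = fun ω => ∑ a, X.contribution p a (T ω) := by
  funext ω
  simp only [muHat, betaHat, A.covariance_exposure_instrument h, integral_instrument h]
  exact Finset.mul_sum _ _ _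

end Anchor

section Dependence

variable (A : X.Assumptions Wl Wh M)
include A

lemma dependsOn_exposure (a : ι) : DependsOn (X.exposure a) (X.outNbrs a : Set ι) := by
  rw [funext (A.exposure_eq a)]
  exact dependsOn_sum_bit_mul fun r hr => by rw [fullEdge_eq_zero hr, zero_mul]

lemma dependsOn_exposure_compl (a : ι) : DependsOn (X.exposure a) {a}ᶜ := by
  rw [funext (A.exposure_eq a)]
  refine dependsOn_sum_bit_mul fun r hr => ?_
  rw [show r = a by simpa using hr, A.w_self, mul_zero]

lemma dependsOn_instrument (a : ι) : DependsOn (X.instrument a) (X.anchorNbrs a) :=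
  dependsOn_sum_bit_mul fun _ hr => by_contra fun hu => hr (A.mem_anchorNbrs hu)

lemma dependsOn_weightHat (p : ℝ) (a : ι) :
    DependsOn (X.weightHat p id a) (X.outNbrs a : Set ι) := by
  rw [funext (A.weightHat_eq p id a)]
  refine dependsOn_comp (dependsOn_sum_bit_mul fun r hr => ?_) (· + _)
  rw [fullEdge_eq_zero hr, A.c_of_notMem (mt A.mem_outNbrs hr), sub_zero, mul_zero, zero_div]

lemma fullEdge_sub_c_eq_zero (hr : r ∈ X.anchorNbrs a) : X.fullEdge a r - X.c a r = 0 := by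
  rw [A.fullEdge_eq_one hr.1, A.c_of_mem hr.1, sub_self]

lemma dependsOn_anchorExposure (a : ι) : DependsOn (X.anchorExposure a) (X.anchorNbrs a) := by
  refine dependsOn_sum_bit_mul fun r hr => ?_
  by_cases hra : r = a
  · rw [hra, A.w_self, mul_zero]
  · rw [A.c_of_notMem fun hG => hr ⟨hG, hra⟩, zero_mul]

lemma dependsOn_weightHat_compl (p : ℝ) (a : ι) :
    DependsOn (X.weightHat p id a) (X.anchorNbrs a)ᶜ := by
  rw [funext (A.weightHat_eq p id a)]
  refine dependsOn_comp (dependsOn_sum_bit_mul fun r hr => ?_) (· + _)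
  rw [A.fullEdge_sub_c_eq_zero (Set.notMem_compl_iff.1 hr), mul_zero, zero_div]

lemma dependsOn_residualOutcome (a : ι) : DependsOn (X.residualOutcome a) (X.anchorNbrs a)ᶜ := by
  rw [funext (A.residualOutcome_eq a)]
  refine dependsOn_comp₂ (dependsOn_sum_bit_mul fun r hr => ?_)
    (dependsOn_bit (r := a) fun h => h.2 rfl) fun x y => X.α a + X.β a * x + X.γ a * y
  rw [A.fullEdge_sub_c_eq_zero (Set.notMem_compl_iff.1 hr), zero_mul]

lemma dependsOn_contribution (p : ℝ) (a : ι) :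
    DependsOn (X.contribution p a) (X.relevantUnits a : Set ι) := by
  intro t t' htt'
  have hself : t a = t' a := htt' a (mem_relevantUnits.2 (.inl rfl))
  have hout : ∀ r ∈ (X.outNbrs a : Set ι), t r = t' r := fun r hr =>
    htt' r (mem_relevantUnits.2 (.inr hr))
  have hZ : X.instrument a t = X.instrument a t' :=
    A.dependsOn_instrument a fun r hr => hout r (A.mem_outNbrs hr.1)
  simp only [contribution, slopeEstimate, centeredInstrument, gammaHat, outcome, id, hself, hZ,
    A.dependsOn_exposure a hout, A.dependsOn_weightHat p a hout]

lemma hasDependencyNbhds_contribution [IsProbabilityMeasure P] (h : IsBernoulliDesign P p T) :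
    HasDependencyNbhds (fun a ω => X.contribution p a (T ω)) (overlapNbhd X.relevantUnits) P :=
  hasDependencyNbhds_overlapNbhd h.measurable h.indep (fun _ => .of_discrete)
    (A.dependsOn_contribution p)

end Dependence

section Unbiasedness

variable [IsProbabilityMeasure P] (A : X.Assumptions Wl Wh M)
include A

lemma integral_gammaHat (h : IsBernoulliDesign P p T) (hp : p ≠ 0) (hp' : 1 - p ≠ 0) (a : ι) :
    ∫ ω, X.gammaHat p id a (T ω) ∂P = X.γ a := by
  set f : (ι → Bool) → ℝ := fun t => X.α a + X.β a * X.exposure a t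
  have hf : DependsOn f {a}ᶜ :=
    dependsOn_comp (A.dependsOn_exposure_compl a) fun x => X.α a + X.β a * x
  have hsplit (t : ι → Bool) : X.gammaHat p id a t =
      bit (t a) * f t / p - (f t - bit (t a) * f t) / (1 - p) + bit (t a) * X.γ a / p := by
    simp only [gammaHat, outcome, id, f]
    linear_combination (X.γ a / p + X.γ a / (1 - p)) * bit_mul_self (t a)
  have htreated : Integrable (fun ω => bit (T ω a) * f (T ω)) P :=
    h.integrable fun t => bit (t a) * f t
  have hcontrol : Integrable (fun ω => f (T ω) - bit (T ω a) * f (T ω)) P :=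
    (h.integrable f).sub htreated
  simp only [hsplit]
  rw [integral_add (h.integrable fun t =>
      bit (t a) * f t / p - (f t - bit (t a) * f t) / (1 - p))
      (h.integrable fun t => bit (t a) * X.γ a / p),
    integral_sub (htreated.div_const p) (hcontrol.div_const (1 - p)), integral_div, integral_div,
    integral_div, integral_sub (h.integrable f) htreated, h.integral_bit_mul hf,
    integral_mul_const, h.integral_bit]
  field_simp
  ring

lemma integral_weightHat (h : IsBernoulliDesign P p T) (hp : p ≠ 0) (a : ι) :
    ∫ ω, X.weightHat p id a (T ω) ∂P = X.exposure a fun _ => true := by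
  simp only [A.weightHat_eq, A.exposure_eq, id]
  rw [integral_add (h.integrable fun t =>
      ∑ r, bit (t r) * (X.w a r * (X.fullEdge a r - X.c a r) / p)) (integrable_const _),
    h.integral_sum_bit_mul, Finset.mul_sum, integral_const, probReal_univ, one_smul,
    ← Finset.sum_add_distrib]
  refine Finset.sum_congr rfl fun r _ => ?_
  simp only [bit, if_true]
  field_simp
  ring

lemma integral_outcome_mul_centeredInstrument_mul_weightHat (h : IsBernoulliDesign P p T)
    (hp : p ≠ 0) (a : ι) :
    ∫ ω, X.outcome a (T ω) * X.centeredInstrument p a (T ω) * X.weightHat p id a (T ω) ∂P =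
      p * (1 - p) * X.instrumentStrength a * (X.β a * X.exposure a fun _ => true) := by
  have hZ : DependsOn (X.centeredInstrument p a) (X.anchorNbrs a) :=
    dependsOn_comp (A.dependsOn_instrument a) (· - p * ∑ r, X.u a r)
  have hxZ : DependsOn (fun t => X.anchorExposure a t * X.centeredInstrument p a t)
      (X.anchorNbrs a) := dependsOn_comp₂ (A.dependsOn_anchorExposure a) hZ (· * ·)
  have hW := A.dependsOn_weightHat_compl p a
  have hYW : DependsOn (fun t => X.residualOutcome a t * X.weightHat p id a t)
      (X.anchorNbrs a)ᶜ := dependsOn_comp₂ (A.dependsOn_residualOutcome a) hW (· * ·)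
  have hsplit (t : ι → Bool) :
      X.outcome a t * X.centeredInstrument p a t * X.weightHat p id a t =
        X.β a * (X.anchorExposure a t * X.centeredInstrument p a t * X.weightHat p id a t) +
        X.centeredInstrument p a t * (X.residualOutcome a t * X.weightHat p id a t) := by
    rw [residualOutcome]
    ring
  simp only [hsplit]
  rw [integral_add (h.integrable fun t => X.β a * (X.anchorExposure a t *
      X.centeredInstrument p a t * X.weightHat p id a t)) (h.integrable fun t =>
      X.centeredInstrument p a t * (X.residualOutcome a t * X.weightHat p id a t)),
    integral_const_mul, h.integral_mul disjoint_compl_right hxZ hW,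
    h.integral_mul disjoint_compl_right hZ hYW, integral_centeredInstrument h,
    integral_mul_centeredInstrument h, A.covariance_anchorExposure_instrument h,
    A.integral_weightHat h hp]
  ring

end Unbiasedness

section Bounds

variable (A : X.Assumptions Wl Wh M)
include A

lemma one_le_card_outNbrs (a : ι) : 1 ≤ (X.outNbrs a).card := by
  obtain ⟨r, hr⟩ := A.exists_u_ne_zero a
  exact Finset.card_pos.2 ⟨r, A.mem_outNbrs (A.u_support a r hr)⟩

lemma one_le_dA (a : ι) : 1 ≤ X.dA :=
  (A.one_le_card_outNbrs a).trans (X.card_outNbrs_le_dA a)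

lemma one_le_dR (a : ι) : 1 ≤ X.dR := by
  obtain ⟨r, hr⟩ := A.exists_u_ne_zero a
  have ha : a ∈ X.inNbrs r := by simp [inNbrs, A.anchor a r (A.u_support a r hr)]
  exact (Finset.card_pos.2 ⟨a, ha⟩ : 0 < _).trans_le (X.card_inNbrs_le_dR r)

lemma card_overlapNbhd_relevantUnits_le (a : ι) :
    (overlapNbhd X.relevantUnits a).card ≤ 4 * X.dA * X.dR :=
  calc (overlapNbhd X.relevantUnits a).card
      ≤ (X.dA + 1) * (X.dR + 1) := X.card_overlapNbhd_relevantUnits_le a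
    _ ≤ (2 * X.dA) * (2 * X.dR) :=
        Nat.mul_le_mul (by linarith [A.one_le_dA a]) (by linarith [A.one_le_dR a])
    _ = 4 * X.dA * X.dR := by ring

lemma M_nonneg (a : ι) : 0 ≤ M := (abs_nonneg _).trans (A.outcome_bound a fun _ => true)

lemma Wh_nonneg (hWl : 0 < Wl) (a : ι) : 0 ≤ Wh := by
  obtain ⟨r, hr⟩ := A.exists_u_ne_zero a
  obtain ⟨hG, hra⟩ := A.mem_anchorNbrs hr
  have hmem := A.mem_outNbrs hG
  have hcard : (0 : ℝ) < (X.outNbrs a).card := by exact_mod_cast A.one_le_card_outNbrs a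
  have hle := (A.w_lower a r hmem hra).trans (A.w_upper a r hmem hra)
  exact hWl.le.trans ((div_le_div_iff_of_pos_right hcard).1 hle)

lemma estimatorBound_nonneg (hp₀ : 0 < p₀) (hWl : 0 < Wl) (a : ι) :
    0 ≤ estimatorBound p₀ Wl Wh M := by
  have hM := A.M_nonneg a
  have hWh := A.Wh_nonneg hWl a
  rw [estimatorBound]
  positivity

lemma sum_abs_w_mul_fullEdge_le (hWl : 0 < Wl) (a : ι) :
    ∑ r, |X.w a r| * X.fullEdge a r ≤ Wh := by
  have hcard : (0 : ℝ) < (X.outNbrs a).card := by exact_mod_cast A.one_le_card_outNbrs a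
  calc ∑ r, |X.w a r| * X.fullEdge a r = ∑ r ∈ X.outNbrs a, |X.w a r| * X.fullEdge a r :=
        (Finset.sum_subset (Finset.subset_univ _) fun r _ hr => by
          rw [fullEdge_eq_zero hr, mul_zero]).symm
    _ ≤ ∑ _r ∈ X.outNbrs a, Wh / (X.outNbrs a).card := by
        refine Finset.sum_le_sum fun r hr => ?_
        rw [fullEdge_eq_one_of_mem hr, mul_one]
        by_cases hra : r = a
        · rw [hra, A.w_self, abs_zero]
          exact div_nonneg (A.Wh_nonneg hWl a) hcard.le
        · exact A.w_upper a r hr hra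
    _ = Wh := by
        rw [Finset.sum_const, nsmul_eq_mul]
        field_simp

lemma abs_weightHat_le (hWl : 0 < Wl) (hp : 0 < p) (hp' : p ≤ 1) (a : ι) (t : ι → Bool) :
    |X.weightHat p id a t| ≤ Wh / p := by
  have hterm (r : ι) : |bit (t r) * (X.w a r * (X.fullEdge a r - X.c a r) / p) +
      X.w a r * X.c a r| ≤ |X.w a r| * X.fullEdge a r / p := by
    by_cases h : (a, r) ∈ X.G
    · rw [A.c_of_mem h, A.fullEdge_eq_one h, sub_self, mul_zero, zero_div, mul_zero, zero_add,
        mul_one, mul_one]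
      exact le_div_self (abs_nonneg _) hp hp'
    · have hE : 0 ≤ X.fullEdge a r := bit_nonneg _
      rw [A.c_of_notMem h, sub_zero, mul_zero, add_zero, abs_mul, abs_div, abs_mul, abs_of_pos hp,
        abs_of_nonneg (bit_nonneg _), abs_of_nonneg hE]
      exact mul_le_of_le_one_left (by positivity) (bit_le_one _)
  rw [A.weightHat_eq, ← Finset.sum_add_distrib]
  calc |∑ r, (bit (t r) * (X.w a r * (X.fullEdge a r - X.c a r) / p) + X.w a r * X.c a r)|
      ≤ ∑ r, |X.w a r| * X.fullEdge a r / p :=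
        (Finset.abs_sum_le_sum_abs _ _).trans (Finset.sum_le_sum fun r _ => hterm r)
    _ ≤ Wh / p := by
        rw [← Finset.sum_div]
        exact div_le_div_of_nonneg_right (A.sum_abs_w_mul_fullEdge_le hWl a) hp.le

lemma sum_u_pos (a : ι) : 0 < ∑ r, X.u a r := by
  obtain ⟨r, hr⟩ := A.exists_u_ne_zero a
  exact Finset.sum_pos' (fun r _ => A.u_nonneg a r)
    ⟨r, Finset.mem_univ r, (A.u_nonneg a r).lt_of_ne' hr⟩

lemma abs_instrumentStrength (a : ι) :
    |X.instrumentStrength a| = ∑ r, |X.w a r| * X.u a r := by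
  obtain ⟨s, hs⟩ := A.exists_u_ne_zero a
  have hws : X.w a s ≠ 0 := fun h => by simpa [h] using A.w_same_sign a s s hs hs
  have hsum : 0 ≤ ∑ r, |X.w a r| * X.u a r :=
    Finset.sum_nonneg fun r _ => mul_nonneg (abs_nonneg _) (A.u_nonneg a r)
  have hscaled : X.w a s * X.instrumentStrength a = |X.w a s| * ∑ r, |X.w a r| * X.u a r := by
    rw [instrumentStrength, Finset.mul_sum, Finset.mul_sum]
    refine Finset.sum_congr rfl fun r _ => ?_
    by_cases hr : X.u a r = 0
    · simp only [hr, mul_zero]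
    · rw [← mul_assoc, ← mul_assoc, ← abs_mul, abs_of_pos (A.w_same_sign a s r hs hr)]
  have habs := congrArg abs hscaled
  rw [abs_mul, abs_mul, abs_abs, abs_of_nonneg hsum] at habs
  exact mul_left_cancel₀ (abs_ne_zero.2 hws) habs

lemma le_abs_instrumentStrength (a : ι) :
    Wl / (X.outNbrs a).card * ∑ r, X.u a r ≤ |X.instrumentStrength a| := by
  rw [A.abs_instrumentStrength, Finset.mul_sum]
  refine Finset.sum_le_sum fun r _ => ?_
  by_cases hr : X.u a r = 0
  · simp only [hr, mul_zero, le_refl]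
  · obtain ⟨hG, hra⟩ := A.mem_anchorNbrs hr
    exact mul_le_mul_of_nonneg_right (A.w_lower a r (A.mem_outNbrs hG) hra) (A.u_nonneg a r)

lemma instrumentStrength_ne_zero (hWl : 0 < Wl) (a : ι) : X.instrumentStrength a ≠ 0 := by
  have hcard : (0 : ℝ) < (X.outNbrs a).card := by exact_mod_cast A.one_le_card_outNbrs a
  exact abs_pos.1 <|
    (mul_pos (div_pos hWl hcard) (A.sum_u_pos a)).trans_le (A.le_abs_instrumentStrength a)

lemma abs_centeredInstrument_le (hp : 0 ≤ p) (hp' : p ≤ 1) (a : ι) (t : ι → Bool) :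
    |X.centeredInstrument p a t| ≤ ∑ r, X.u a r := by
  rw [centeredInstrument, instrument, Finset.mul_sum, ← Finset.sum_sub_distrib]
  refine (Finset.abs_sum_le_sum_abs _ _).trans (Finset.sum_le_sum fun r _ => ?_)
  rw [← sub_mul, abs_mul, abs_of_nonneg (A.u_nonneg a r)]
  refine mul_le_of_le_one_left (A.u_nonneg a r) (abs_le.2 ⟨?_, ?_⟩)
  · linarith [bit_nonneg (t r)]
  · linarith [bit_le_one (t r)]

variable (hp₀ : 0 < p₀) (hp : p₀ ≤ p) (hp' : p ≤ 1 - p₀)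
include hp₀ hp hp'

lemma abs_gammaHat_le (a : ι) (t : ι → Bool) : |X.gammaHat p id a t| ≤ M / p₀ := by
  have hM := A.M_nonneg a
  have hY := A.outcome_bound a t
  rw [gammaHat]
  cases h : t a
  · simp only [id, h, bit, Bool.false_eq_true, if_false, zero_mul, zero_div, zero_sub, sub_zero,
      one_mul, abs_neg, abs_div]
    rw [abs_of_pos (show 0 < 1 - p by linarith)]
    exact div_le_div₀ hM hY hp₀ (by linarith)
  · simp only [id, h, bit, if_true, one_mul, sub_self, zero_mul, zero_div, sub_zero, abs_div]
    rw [abs_of_pos (hp₀.trans_le hp)]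
    exact div_le_div₀ hM hY hp₀ hp

lemma abs_slopeEstimate_le (hWl : 0 < Wl) (a : ι) (t : ι → Bool) :
    |X.slopeEstimate p a t| ≤ M * X.dA / (p₀ ^ 2 * Wl) := by
  have hM := A.M_nonneg a
  have hp0 : 0 < p := hp₀.trans_le hp
  have hq0 : p₀ ≤ 1 - p := by linarith
  have hvar : 0 < p * (1 - p) := mul_pos hp0 (hp₀.trans_le hq0)
  have hR : (0 : ℝ) < (X.outNbrs a).card := by exact_mod_cast A.one_le_card_outNbrs a
  have hRd : ((X.outNbrs a).card : ℝ) ≤ X.dA := by exact_mod_cast X.card_outNbrs_le_dA a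
  have hd : (0 : ℝ) < X.dA := hR.trans_le hRd
  have hU := A.sum_u_pos a
  have hstrength : Wl / X.dA * ∑ r, X.u a r ≤ |X.instrumentStrength a| :=
    le_trans (by gcongr) (A.le_abs_instrumentStrength a)
  rw [slopeEstimate, abs_div, abs_mul, abs_mul, abs_of_pos hvar]
  calc |X.outcome a t| * |X.centeredInstrument p a t| / (p * (1 - p) * |X.instrumentStrength a|)
      ≤ M * (∑ r, X.u a r) / (p₀ * p₀ * (Wl / X.dA * ∑ r, X.u a r)) := by
        gcongr
        · exact A.outcome_bound a t
        · exact A.abs_centeredInstrument_le hp0.le (by linarith) a t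
    _ = M * X.dA / (p₀ ^ 2 * Wl) := by field_simp

lemma abs_contribution_le (hWl : 0 < Wl) (a : ι) (t : ι → Bool) :
    |X.contribution p a t| ≤ estimatorBound p₀ Wl Wh M * X.dA / Fintype.card ι := by
  have hM := A.M_nonneg a
  have hWh := A.Wh_nonneg hWl a
  have hd : (1 : ℝ) ≤ X.dA := by exact_mod_cast A.one_le_dA a
  have hW : |X.weightHat p id a t| ≤ Wh / p₀ :=
    (A.abs_weightHat_le hWl (hp₀.trans_le hp) (by linarith) a t).trans (by gcongr)
  rw [contribution, abs_mul, abs_of_nonneg (by positivity), one_div_mul_eq_div]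
  gcongr
  calc |X.slopeEstimate p a t * X.weightHat p id a t + X.gammaHat p id a t|
      ≤ |X.slopeEstimate p a t| * |X.weightHat p id a t| + |X.gammaHat p id a t| := by
        rw [← abs_mul]
        exact abs_add_le _ _
    _ ≤ M * X.dA / (p₀ ^ 2 * Wl) * (Wh / p₀) + M / p₀ * X.dA := by
        gcongr
        · exact A.abs_slopeEstimate_le hp₀ hp hp' hWl a t
        · exact (A.abs_gammaHat_le hp₀ hp hp' a t).trans
            (le_mul_of_one_le_right (by positivity) hd)
    _ = estimatorBound p₀ Wl Wh M * X.dA := by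
        rw [estimatorBound]
        field_simp

end Bounds

section Estimator

variable [IsProbabilityMeasure P] (A : X.Assumptions Wl Wh M) (h : IsBernoulliDesign P p T)
include A h

lemma memLp_muHat (q : ENNReal) : MemLp (X.muHat P p T) q P := by
  rw [A.muHat_eq h]
  exact h.memLp (fun t => ∑ a, X.contribution p a t) q

variable (hWl : 0 < Wl)
include hWl

lemma integral_contribution (hp : p ≠ 0) (hp' : 1 - p ≠ 0) (a : ι) :
    ∫ ω, X.contribution p a (T ω) ∂P =
      (1 / (Fintype.card ι : ℝ)) * (X.outcome a (fun _ => true) - X.outcome a fun _ => false) := by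
  have hs := A.instrumentStrength_ne_zero hWl a
  simp only [contribution, slopeEstimate, div_mul_eq_mul_div _ _ (X.weightHat p id a _)]
  rw [integral_const_mul, integral_add (h.integrable fun t => X.outcome a t *
      X.centeredInstrument p a t * X.weightHat p id a t / (p * (1 - p) * X.instrumentStrength a))
      (h.integrable (X.gammaHat p id a)), integral_div, A.integral_gammaHat h hp hp',
    A.integral_outcome_mul_centeredInstrument_mul_weightHat h hp,
    mul_div_cancel_left₀ _ (mul_ne_zero (mul_ne_zero hp hp') hs)]
  simp only [outcome, exposure_false, bit, if_true, Bool.false_eq_true, if_false]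
  ring

lemma integral_muHat (hp : p ≠ 0) (hp' : 1 - p ≠ 0) :
    ∫ ω, X.muHat P p T ω ∂P = X.totalEffect := by
  rw [A.muHat_eq h, integral_finsetSum _ fun a _ => h.integrable (X.contribution p a)]
  simp only [A.integral_contribution h hWl hp hp', totalEffect, Finset.mul_sum]

lemma variance_muHat_le (hp₀ : 0 < p₀) (hp : p₀ ≤ p) (hp' : p ≤ 1 - p₀) :
    Var[X.muHat P p T; P] ≤
      4 * estimatorBound p₀ Wl Wh M ^ 2 * ((X.dA : ℝ) ^ 3 * X.dR / Fintype.card ι) := by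
  rw [A.muHat_eq h]
  refine ((A.hasDependencyNbhds_contribution h).variance_sum_le
    (fun a => (h.memLp (X.contribution p a) 2).1.aemeasurable)
    (fun a => .of_forall fun ω => A.abs_contribution_le hp₀ hp hp' hWl a (T ω))
    A.card_overlapNbhd_relevantUnits_le).trans_eq ?_
  push_cast
  rcases eq_or_ne (Fintype.card ι : ℝ) 0 with hn | hn
  · simp [hn]
  · field_simp

end Estimator

end Assumptions

section Asymptotics

lemma card_mul_sq_mul_cube_le {n d r K δ σ : ℝ} (hd : 0 ≤ d) (hK : 0 ≤ K) (hδ : 0 < δ)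
    (hσ : 0 < σ) (hvar : δ ≤ n * σ ^ 2) :
    n * (4 * d * r) ^ 2 * (K * d / n / σ) ^ 3 ≤
      16 * K ^ 3 / √δ ^ 3 * √(d ^ 10 * r ^ 4 / n) := by
  have hn : 0 < n := pos_of_mul_pos_left (hδ.trans_le hvar) (sq_nonneg σ)
  have hsqrt : √(d ^ 10 * r ^ 4 / n) = d ^ 5 * r ^ 2 / √n := by
    rw [Real.sqrt_div (by positivity), show d ^ 10 * r ^ 4 = (d ^ 5 * r ^ 2) ^ 2 by ring,
      Real.sqrt_sq (by positivity)]
  have hδσ : √δ ≤ √n * σ := by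
    rw [← Real.sqrt_sq hσ.le, ← Real.sqrt_mul hn.le]
    exact Real.sqrt_le_sqrt hvar
  have hn' : √n ^ 2 = n := Real.sq_sqrt hn.le
  calc n * (4 * d * r) ^ 2 * (K * d / n / σ) ^ 3
      = 16 * K ^ 3 / (√n * σ) ^ 3 * (d ^ 5 * r ^ 2 / √n) := by
        set s := √n
        rw [← hn']
        have hs : 0 < s := Real.sqrt_pos.2 hn
        field_simp
        ring
    _ ≤ 16 * K ^ 3 / √δ ^ 3 * √(d ^ 10 * r ^ 4 / n) := by
        rw [hsqrt]
        gcongr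

variable {ι Ω : ℕ → Type*} [∀ n, Fintype (ι n)] [∀ n, MeasurableSpace (Ω n)]
  {P : ∀ n, Measure (Ω n)} [∀ n, IsProbabilityMeasure (P n)] {p : ℕ → ℝ}
  {T : ∀ n, Ω n → ι n → Bool} {X : ∀ n, UnipartiteExperiment (ι n)} {Wl Wh M p₀ δ : ℝ}

lemma tendsto_card_mul_sq_mul_cube (A : ∀ n, (X n).Assumptions Wl Wh M) (hp₀ : 0 < p₀)
    (hWl : 0 < Wl) (hδ : 0 < δ) {σ : ℕ → ℝ} (hσ : ∀ᶠ n in atTop, 0 < σ n)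
    (hvar : ∀ᶠ n in atTop, δ ≤ (Fintype.card (ι n) : ℝ) * σ n ^ 2)
    (hlim : Tendsto (fun n => ((X n).dA : ℝ) ^ 10 * ((X n).dR : ℝ) ^ 4 / (Fintype.card (ι n) : ℝ))
      atTop (𝓝 0)) :
    Tendsto (fun n => (Fintype.card (ι n) : ℝ) * ((4 * (X n).dA * (X n).dR : ℕ) : ℝ) ^ 2 *
      (estimatorBound p₀ Wl Wh M * (X n).dA / Fintype.card (ι n) / σ n) ^ 3) atTop (𝓝 0) := by
  set K := estimatorBound p₀ Wl Wh M
  have hK : 0 ≤ K := by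
    obtain ⟨n, hn⟩ := hvar.exists
    have hcard : (0 : ℝ) < Fintype.card (ι n) :=
      pos_of_mul_pos_left (hδ.trans_le hn) (sq_nonneg _)
    obtain ⟨a⟩ := Fintype.card_pos_iff.1 (Nat.cast_pos.1 hcard)
    exact (A n).estimatorBound_nonneg hp₀ hWl a
  have hupper := hlim.sqrt.const_mul (16 * K ^ 3 / √δ ^ 3)
  rw [Real.sqrt_zero, mul_zero] at hupper
  refine squeeze_zero' ?_ ?_ hupper
  · filter_upwards [hσ] with n hσn
    positivity
  · filter_upwards [hvar, hσ] with n hn hσn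
    push_cast
    exact card_mul_sq_mul_cube_le (Nat.cast_nonneg _) hK hδ hσn hn

lemma tendstoInDistribution_muHat (hp₀ : 0 < p₀) (hWl : 0 < Wl)
    (hp : ∀ n, p₀ ≤ p n ∧ p n ≤ 1 - p₀) (h : ∀ n, IsBernoulliDesign (P n) (p n) (T n))
    (A : ∀ n, (X n).Assumptions Wl Wh M) (hδ : 0 < δ)
    (hvar : ∀ᶠ n in atTop, δ ≤ (Fintype.card (ι n) : ℝ) * Var[(X n).muHat (P n) (p n) (T n); P n])
    (hlim : Tendsto (fun n => ((X n).dA : ℝ) ^ 10 * ((X n).dR : ℝ) ^ 4 / (Fintype.card (ι n) : ℝ))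
      atTop (𝓝 0)) :
    TendstoInDistribution
      (fun n ω => ((X n).muHat (P n) (p n) (T n) ω -
        ∫ ω', (X n).muHat (P n) (p n) (T n) ω' ∂P n) / √Var[(X n).muHat (P n) (p n) (T n); P n])
      atTop id P (gaussianReal 0 1) := by
  obtain ⟨σ, hσdef⟩ : ∃ σ : ℕ → ℝ, ∀ n, √Var[(X n).muHat (P n) (p n) (T n); P n] = σ n :=
    ⟨_, fun _ => rfl⟩
  have hσ2 (n) : Var[(X n).muHat (P n) (p n) (T n); P n] = σ n ^ 2 := by
    rw [← hσdef, Real.sq_sqrt (variance_nonneg _ _)]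
  simp only [hσ2] at hvar
  have hσ : ∀ᶠ n in atTop, 0 < σ n := hvar.mono fun n hn => by
    rw [← hσdef, Real.sqrt_pos, hσ2]
    exact pos_of_mul_pos_right (hδ.trans_le hn) (Nat.cast_nonneg _)
  have hrate := tendsto_card_mul_sq_mul_cube A hp₀ hWl hδ hσ hvar hlim
  simp only [hσdef]
  simp only [fun n => (A n).muHat_eq (h n)] at hσ2 ⊢
  exact tendstoInDistribution_of_hasDependencyNbhds
    (fun n => (A n).hasDependencyNbhds_contribution (h n))
    (fun n a => ((h n).memLp ((X n).contribution (p n) a) 2).1.aemeasurable)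
    (fun n a => .of_forall fun ω => (A n).abs_contribution_le hp₀ (hp n).1 (hp n).2 hWl a _)
    (fun n => (A n).card_overlapNbhd_relevantUnits_le) hσ hσ2 hrate

end Asymptotics

end UnipartiteExperiment

theorem corollary2 (p₀ Wl Wh M : ℝ) (hp₀ : 0 < p₀) (hWl : 0 < Wl) :
    -- the variance bound, with a constant depending only on `p₀`, `Wl`, `Wh`, `M`
    (∃ C : ℝ, ∀ (ι : Type*) [Fintype ι] (Ω : Type*) [MeasurableSpace Ω]
      (P : Measure Ω) [IsProbabilityMeasure P] (p : ℝ) (T : Ω → ι → Bool)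
      (X : UnipartiteExperiment ι),
      p₀ ≤ p → p ≤ 1 - p₀ → UnipartiteExperiment.IsBernoulliDesign P p T →
      X.Assumptions Wl Wh M →
      Var[X.muHat P p T; P] ≤ C * ((X.dA : ℝ) ^ 3 * (X.dR : ℝ) / (Fintype.card ι : ℝ))) ∧
    -- consistency and asymptotic normality along sequences of experiments
    (∀ (ι : ℕ → Type*) [∀ n, Fintype (ι n)] (Ω : ℕ → Type*) [∀ n, MeasurableSpace (Ω n)]
      (P : ∀ n, Measure (Ω n)) [∀ n, IsProbabilityMeasure (P n)] (p : ℕ → ℝ)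
      (T : ∀ n, Ω n → ι n → Bool) (X : ∀ n, UnipartiteExperiment (ι n)),
      (∀ n, p₀ ≤ p n ∧ p n ≤ 1 - p₀) →
      (∀ n, UnipartiteExperiment.IsBernoulliDesign (P n) (p n) (T n)) →
      (∀ n, (X n).Assumptions Wl Wh M) →
      (Tendsto (fun n => ((X n).dA : ℝ) ^ 3 * ((X n).dR : ℝ) / (Fintype.card (ι n) : ℝ))
          atTop (𝓝 0) →
        ∀ ε : ℝ, 0 < ε →
          Tendsto (fun n => P n {ω | ε ≤ |(X n).muHat (P n) (p n) (T n) ω - (X n).totalEffect|})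
            atTop (𝓝 0)) ∧
      ((∃ δ : ℝ, 0 < δ ∧ ∀ᶠ n in atTop,
          δ ≤ (Fintype.card (ι n) : ℝ) * Var[(X n).muHat (P n) (p n) (T n); P n]) →
        Tendsto (fun n => ((X n).dA : ℝ) ^ 10 * ((X n).dR : ℝ) ^ 4 / (Fintype.card (ι n) : ℝ))
          atTop (𝓝 0) →
        TendstoInDistribution
          (fun n ω => ((X n).muHat (P n) (p n) (T n) ω - (X n).totalEffect) /
            Real.sqrt (Var[(X n).muHat (P n) (p n) (T n); P n]))
          atTop (id : ℝ → ℝ) P (gaussianReal 0 1))) := by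
  refine ⟨⟨4 * UnipartiteExperiment.estimatorBound p₀ Wl Wh M ^ 2,
    fun ι _ Ω _ P _ p T X hp hp' h A => A.variance_muHat_le h hWl hp₀ hp hp'⟩,
    fun ι _ Ω _ P _ p T X hp h A => ?_⟩
  have hmean (n) : ∫ ω, (X n).muHat (P n) (p n) (T n) ω ∂P n = (X n).totalEffect :=
    (A n).integral_muHat (h n) hWl (hp₀.trans_le (hp n).1).ne' (by linarith [(hp n).2])
  simp only [← hmean]
  refine ⟨fun hlim ε hε => ?_, fun ⟨δ, hδ, hvar⟩ hlim =>
    UnipartiteExperiment.tendstoInDistribution_muHat hp₀ hWl hp h A hδ hvar hlim⟩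
  have hupper := hlim.const_mul (4 * UnipartiteExperiment.estimatorBound p₀ Wl Wh M ^ 2)
  rw [mul_zero] at hupper
  exact tendsto_measure_le_abs_sub_integral
    (fun n => (A n).memLp_muHat (h n) 2)
    (squeeze_zero (fun n => variance_nonneg _ _)
      (fun n => (A n).variance_muHat_le (h n) hWl hp₀ (hp n).1 (hp n).2) hupper) hε
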